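/- Let $\mathcal S(]-\infty,0],\mathbb C)$ be the space of functions $F\in C^\infty(]-\infty,0],\mathbb C)$ such that $\lim_{t\to-\infty}|t|^mF^{(n)}(t)=0$ for all integers $m,n\ge 0$. Let $F\in\mathcal S(]-\infty,0],\mathbb C)$. For $a\le 0$ and $\Re(s)<0$ put $$F^{(s)}(a)=\frac1{\Gamma(-s)}\int_0^{+\infty}u^{-s-1}F(a-u)\,du .$$ For every $a\le0$ this function of $s$ has a unique entire extension, still denoted $s\mapsto F^{(s)}(a)$, which for $s\in\mathbb N$ is the usual derivative of order $s$ of $F$ at $a$ (one-sided at $a=0$). Integrals over $\Re(s)=c$ are taken over the upward vertical line; all those below converge absolutely. The following hold. (i) For all $t<0$, the series $\sum_{n\ge1}F(nt)$ converges absolutely, and for all integers $N\ge1$ and all $c\in\,]2N-1,2N+1[$ (in particular for $c=2N$), $$\sum_{n=1}^{+\infty}F(nt)=\frac1{2i\pi}\int_{\Re(s)=-\frac32}\Gamma(-s)\zeta(-s)F^{(s)}(0)(-t)^s\,ds$$ $$=-\frac{F^{(-1)}(0)}{t}+\sum_{k=0}^{2N-1}\frac{\zeta(-k)}{k!}F^{(k)}(0)\,t^k+\frac1{2i\pi}\int_{\Re(s)=c}\Gamma(-s)\zeta(-s)F^{(s)}(0)(-t)^s\,ds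 .$$ (ii) For all $t<0$, all integers $0\le p<q$, all integers $N\ge1$ and all $c\in\,]2N-1,2N+1[$, $$\sum_{n=p+1}^{q}F(nt)=\frac1{2i\pi}\int_{\Re(s)=-\frac32}\Gamma(-s)\zeta(-s)\bigl[F^{(s)}(pt)-F^{(s)}(qt)\bigr](-t)^s\,ds$$ and $$\sum_{n=p}^{q-1}F(nt)=-\frac{F^{(-1)}(pt)-F^{(-1)}(qt)}{t}+\sum_{k=1}^{N}(-1)^k\frac{2\zeta(2k)}{(2\pi)^{2k}}\bigl[F^{(2k-1)}(pt)-F^{(2k-1)}(qt)\bigr]t^{2k-1}$$ $$\qquad+\frac{F(pt)-F(qt)}2+\frac1{2i\pi}\int_{\Re(s)=c}\Gamma(-s)\zeta(-s)\bigl[F^{(s)}(pt)-F^{(s)}(qt)\bigr](-t)^s\,ds .$$ (iii) Let $G(u)=F(-u)$ for $u\ge0$. For all integers $0\le p<q$, all integers $N\ge1$ and all $c\in\,]2N-1,2N+1[$, $$\frac{G(p)+G(q)}2+\sum_{n=p+1}^{q-1}G(n)=\int_p^qG(u)\,du+\sum_{k=1}^{N}(-1)^{k}\frac{2\zeta(2k)}{(2\pi)^{2k}}\bigl[G^{(2k-1)}(p)-G^{(2k-1)}(q)\bigr]$$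 $$\qquad+\frac1{2i\pi}\int_{\Re(s)=c}\Gamma(-s)\zeta(-s)\bigl[F^{(s)}(-p)-F^{(s)}(-q)\bigr]ds .$$ -/

import Mathlib

open Set Filter Topology MeasureTheory
open scoped ContDiff

noncomputable section

/-- The space `S(]-∞, a], ℂ)`: functions that are `C^∞` on the closed half-line `]-∞, a]`
(one-sided derivatives at `a`) and such that `|t|^m F^(n)(t) → 0` as `t → -∞` for all `m`, `n`.
Only the values of `F` on `]-∞, a]` matter. -/
structure IsSchwartzLeft (a : ℝ) (F : ℝ → ℂ) : Prop where
  smooth : ContDiffOn ℝ ∞ F (Iic a)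
  decay : ∀ m n : ℕ,
    Tendsto (fun t : ℝ => ((|t| ^ m : ℝ) : ℂ) * iteratedDerivWithin n F (Iic a) t) atBot (𝓝 0)

/-- `D` is an entire function of `s` which is equal, for `Re s < 0`, to the Riemann-Liouville
expression `(1 / Γ(-s)) ∫_0^∞ u^(-s-1) F(a - u) du`. -/
def IsFracDeriv (F : ℝ → ℂ) (a : ℝ) (D : ℂ → ℂ) : Prop :=
  Differentiable ℂ D ∧
    ∀ s : ℂ, s.re < 0 →
      D s = 1 / Complex.Gamma (-s) * ∫ u in Ioi (0 : ℝ), (u : ℂ) ^ (-s - 1) * F (a - u)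

/-- The fractional derivative `F^(s)(a)`, as a function of `s ∈ ℂ`: the entire extension of the
Riemann-Liouville expression. -/
def fracDeriv (F : ℝ → ℂ) (a : ℝ) : ℂ → ℂ :=
  Classical.epsilon (IsFracDeriv F a)

/-- Absolute convergence of the integral of `f` over the vertical line `Re s = c`. -/
def VerticalIntegrable (c : ℝ) (f : ℂ → ℂ) : Prop :=
  Integrable (fun y : ℝ => f ((c : ℂ) + (y : ℂ) * Complex.I))

/-- `(1 / 2iπ) ∫_{Re s = c} f(s) ds`, the line being oriented upwards (`s = c + iy`,
`ds = i dy`). -/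
def verticalIntegral (c : ℝ) (f : ℂ → ℂ) : ℂ :=
  1 / (2 * Complex.I * Real.pi) *
    ∫ y : ℝ, f ((c : ℂ) + (y : ℂ) * Complex.I) * Complex.I

end

/-! ### Integrals over vertical lines and contour shifts -/

/-! Fix `a ≤ 0` and put `g n u = F^(n)(a - u)`, so that `g n` has derivative `-g (n + 1)` and decays
rapidly. For `Re s < 0` the product `Γ(-s) F^(s)(a)` is the Mellin transform of `g 0` at `-s`.
Mellin inversion on `Re z = 3/2`, at the points `n(-t)` with `n ≥ 1`, can be summed under the
integral sign. The powers `n^(-z)` add up to `ζ(z)`, and `s = -z` gives the integral over `Re s =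
-3/2` (`RapidTower.hasSum_verticalIntegral`).

The other formulas come from moving the line to the right. Integration by parts
(`RapidTower.mellin_add_one`) continues `F^(s)(a)` to an entire function with the usual derivatives
at the integers. It also makes `Γ(-s) F^(s)(a)` decay faster than any power of `|Im s|` in vertical
strips, while `ζ` grows polynomially there (`exists_norm_riemannZeta_le_pow`), so contours can be
shifted. The poles crossed are `s = -1`, from `ζ(-s)`, and `s = 0, ..., 2N - 1`, from `Γ(-s)`. At `s
= 2N` the trivial zero of `ζ` cancels the pole, so every line in `]2N - 1, 2N + 1[` gives the same
integral.

A finite sum is the difference of two infinite sums, based at `pt` and `qt`. The functional equation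
turns `ζ(1 - 2k)` into `ζ(2k)`, and `t = -1` gives the formula for `G`. -/

lemma integrable_of_continuous_of_sq_decay {g : ℝ → ℂ} (hc : Continuous g) {C : ℝ}
    (h : ∀ y : ℝ, 1 ≤ |y| → ‖g y‖ ≤ C / y ^ 2) : Integrable g := by
  obtain ⟨B, hB⟩ := (isCompact_Icc (a := (-1 : ℝ)) (b := 1)).exists_bound_of_continuousOn
    hc.continuousOn
  have hB0 : 0 ≤ B := (norm_nonneg _).trans (hB 0 (by simp))
  have hC0 : 0 ≤ C := by simpa using (norm_nonneg _).trans (h 1 (by simp))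
  refine (integrable_inv_one_add_sq.const_mul (2 * (B + C))).mono' hc.aestronglyMeasurable
    (ae_of_all _ fun y => ?_)
  rw [← div_eq_mul_inv, le_div_iff₀ (by positivity)]
  rcases le_total 1 |y| with hy | hy
  · have hy2 : 1 ≤ y ^ 2 := by rw [← sq_abs]; nlinarith
    have h1 := h y hy
    rw [le_div_iff₀ (by positivity)] at h1
    nlinarith [norm_nonneg (g y)]
  · have hy2 : y ^ 2 ≤ 1 := by rw [← sq_abs]; nlinarith [abs_nonneg y]
    have h1 := hB y (abs_le.mp hy)
    nlinarith [norm_nonneg (g y)]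

/-- A primitive is `arctan (y / b) - (i / 2) log (b² + y²)`. The logarithm is even in `y` and drops
out over a symmetric interval. The limit as `T → ∞` is `π` or `-π` according to the sign of `b`, and
this jump produces the residue. -/
lemma intervalIntegral_inv_add_mul_I {b : ℝ} (hb : b ≠ 0) (T : ℝ) :
    ∫ y in (-T)..T, ((b : ℂ) + y * Complex.I)⁻¹ = ((2 * Real.arctan (T / b) : ℝ) : ℂ) := by
  have hpos : ∀ y : ℝ, 0 < b ^ 2 + y ^ 2 := fun y => by positivity
  have hne : ∀ y : ℝ, (b : ℂ) + y * Complex.I ≠ 0 := fun y h => hb (by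
    simpa using congrArg Complex.re h)
  have hd : ∀ y : ℝ, HasDerivAt
      (fun y : ℝ => ((Real.arctan (y / b) : ℝ) : ℂ)
        - ((Real.log (b ^ 2 + y ^ 2) / 2 : ℝ) : ℂ) * Complex.I)
      (((b : ℂ) + y * Complex.I)⁻¹) y := by
    intro y
    have h1 : HasDerivAt (fun y : ℝ => Real.arctan (y / b)) (1 / (1 + (y / b) ^ 2) * (1 / b)) y :=
      ((hasDerivAt_id y).div_const b).arctan
    have h2 : HasDerivAt (fun y : ℝ => Real.log (b ^ 2 + y ^ 2) / 2)
        ((2 * y) / (b ^ 2 + y ^ 2) / 2) y := by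
      have := (((hasDerivAt_pow 2 y).const_add (b ^ 2)).log (hpos y).ne').div_const 2
      simpa using this
    have := h1.ofReal_comp.sub (h2.ofReal_comp.mul_const Complex.I)
    refine this.congr_deriv ?_
    have hb' : (b : ℂ) ≠ 0 := by exact_mod_cast hb
    have hp : (b : ℂ) ^ 2 + (y : ℂ) ^ 2 ≠ 0 := by exact_mod_cast (hpos y).ne'
    have e : (b : ℂ) ^ 2 + (y : ℂ) ^ 2 = (b + y * Complex.I) * (b - y * Complex.I) := by
      ring_nf; simp
    push_cast
    have e2 : (1 : ℂ) / (1 + (y / b) ^ 2) * (1 / b) = b / (b ^ 2 + y ^ 2) := by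
      have : (1 : ℂ) + (y / b) ^ 2 = (b ^ 2 + y ^ 2) / b ^ 2 := by field_simp
      rw [this]; field_simp
    have hne2 : (b : ℂ) - y * Complex.I ≠ 0 := fun h => hp (by rw [e, h, mul_zero])
    rw [e2]
    have e3 : ((b : ℂ) + y * Complex.I)⁻¹ = (b - y * Complex.I) / (b ^ 2 + y ^ 2) := by
      rw [e, inv_eq_one_div, div_eq_div_iff (hne y) (mul_ne_zero (hne y) hne2)]
      ring
    rw [e3]
    field_simp
  have hc : Continuous fun y : ℝ => ((b : ℂ) + y * Complex.I)⁻¹ :=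
    Continuous.inv₀ (by fun_prop) hne
  rw [intervalIntegral.integral_eq_sub_of_hasDerivAt (fun y _ => hd y) (hc.intervalIntegrable _ _)]
  simp [neg_div, Real.arctan_neg]
  ring

lemma tendsto_intervalIntegral_inv_add_mul_I_of_pos {b : ℝ} (hb : 0 < b) :
    Tendsto (fun T : ℝ => ∫ y in (-T)..T, ((b : ℂ) + y * Complex.I)⁻¹) atTop
      (𝓝 (Real.pi : ℂ)) := by
  simp_rw [intervalIntegral_inv_add_mul_I hb.ne']
  have h := (Real.tendsto_arctan_atTop.mono_right nhdsWithin_le_nhds).comp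
    (tendsto_id.atTop_div_const hb)
  have h2 := (Complex.continuous_ofReal.tendsto _).comp (h.const_mul 2)
  rw [mul_div_cancel₀ _ (two_ne_zero' ℝ)] at h2
  exact h2

lemma tendsto_intervalIntegral_inv_add_mul_I_of_neg {b : ℝ} (hb : b < 0) :
    Tendsto (fun T : ℝ => ∫ y in (-T)..T, ((b : ℂ) + y * Complex.I)⁻¹) atTop
      (𝓝 (-Real.pi : ℂ)) := by
  have h := (tendsto_intervalIntegral_inv_add_mul_I_of_pos (neg_pos.mpr hb)).neg
  refine h.congr fun T => ?_
  rw [intervalIntegral_inv_add_mul_I hb.ne, intervalIntegral_inv_add_mul_I (neg_pos.mpr hb).ne',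
    div_neg, Real.arctan_neg]
  push_cast; ring

/-- `Φ` is meromorphic on the strip `α < Re s < β` with at most a simple pole, at the real
point `w`, of residue `r`, and it decays quadratically at the ends of the strip. -/
structure SimplePoleStrip (Φ : ℂ → ℂ) (α β w : ℝ) (r : ℂ) : Prop where
  exists_regular : ∃ h : ℂ → ℂ, DifferentiableOn ℂ h {s | α < s.re ∧ s.re < β} ∧
    ∀ s : ℂ, α < s.re → s.re < β → s ≠ w → Φ s = h s + r / (s - w)
  exists_bound : ∃ C : ℝ, ∀ s : ℂ, α < s.re → s.re < β → 1 ≤ |s.im| → ‖Φ s‖ ≤ C / s.im ^ 2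

namespace SimplePoleStrip

variable {Φ : ℂ → ℂ} {α β w : ℝ} {r : ℂ}

/-- The value of `Φ` at `w` itself is unconstrained, so on the line through `w` the decomposition
holds only off `y = 0`. That is enough for integrals, and it allows the line `Re s = w` when the
residue vanishes. -/
lemma exists_line (H : SimplePoleStrip Φ α β w r) : ∃ h : ℂ → ℂ,
    DifferentiableOn ℂ h {s | α < s.re ∧ s.re < β} ∧
    (∀ s : ℂ, α < s.re → s.re < β → s ≠ w → Φ s = h s + r / (s - w)) ∧
    ∀ a : ℝ, α < a → a < β → (a ≠ w ∨ r = 0) →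
      (fun y : ℝ => Φ (a + y * Complex.I)) =ᵐ[volume]
        (fun y : ℝ => h (a + y * Complex.I) + r / (a + y * Complex.I - w)) ∧
      Integrable (fun y : ℝ => h (a + y * Complex.I) + r / (a + y * Complex.I - w)) := by
  obtain ⟨h, hd, hΦ⟩ := H.exists_regular
  obtain ⟨C, hC⟩ := H.exists_bound
  refine ⟨h, hd, hΦ, fun a ha hb haw => ?_⟩
  have key : ∀ y : ℝ, y ≠ 0 → Φ (a + y * Complex.I) =
      h (a + y * Complex.I) + r / (a + y * Complex.I - w) := fun y hy =>
    hΦ _ (by simpa using ha) (by simpa using hb) fun e => hy (by simpa using congrArg Complex.im e)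
  constructor
  · filter_upwards [compl_mem_ae_iff.mpr (measure_singleton (0 : ℝ))] with y hy
    exact key y hy
  · refine integrable_of_continuous_of_sq_decay (C := C) ?_ fun y hy => ?_
    · have h1 : Continuous fun y : ℝ => h (a + y * Complex.I) :=
        hd.continuousOn.comp_continuous (by fun_prop) (fun y => by simp [ha, hb])
      refine h1.add ?_
      rcases haw with haw | rfl
      · refine continuous_const.div (by fun_prop) fun y e => haw ?_
        have := congrArg Complex.re e
        simp at this
        linarith
      · simpa using continuous_const
    · have hy0 : y ≠ 0 := by rintro rfl; simp at hy; linarith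
      rw [← key y hy0]
      simpa using hC (a + y * Complex.I) (by simpa using ha) (by simpa using hb) (by simpa using hy)

lemma verticalIntegrable (H : SimplePoleStrip Φ α β w r) {a : ℝ} (ha : α < a) (hb : a < β)
    (haw : a ≠ w ∨ r = 0) : VerticalIntegrable a Φ := by
  obtain ⟨h, -, -, hl⟩ := H.exists_line
  exact (hl a ha hb haw).2.congr (hl a ha hb haw).1.symm

/-- Cauchy's theorem for the regular part `h` on the rectangle of height `2T`. On the horizontal
sides `h = Φ - r / (s - w)` is `O(1 / T)`. -/
lemma tendsto_rectangle (H : SimplePoleStrip Φ α β w r) {h : ℂ → ℂ}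
    (hd : DifferentiableOn ℂ h {s | α < s.re ∧ s.re < β})
    (hΦ : ∀ s : ℂ, α < s.re → s.re < β → s ≠ w → Φ s = h s + r / (s - w))
    {a b : ℝ} (ha : α < a) (hab : a ≤ b) (hb : b < β) :
    Tendsto (fun T : ℝ => (∫ y in (-T)..T, h (b + y * Complex.I))
      - ∫ y in (-T)..T, h (a + y * Complex.I)) atTop (𝓝 0) := by
  obtain ⟨C, hC⟩ := H.exists_bound
  have hbd : ∀ T : ℝ, 1 ≤ |T| → ‖∫ x in a..b, h (x + T * Complex.I)‖
      ≤ (C / T ^ 2 + ‖r‖ / |T|) * |b - a| := by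
    intro T hT
    refine intervalIntegral.norm_integral_le_of_norm_le_const fun x hx => ?_
    rw [uIoc_of_le hab] at hx
    have h1 : α < ((x : ℂ) + T * Complex.I).re := by simpa using ha.trans hx.1
    have h2 : ((x : ℂ) + T * Complex.I).re < β := by simpa using hx.2.trans_lt hb
    have hT0 : 0 < |T| := by linarith
    have hne : (x : ℂ) + T * Complex.I ≠ w := fun e => (abs_pos.mp hT0) (by
      simpa using congrArg Complex.im e)
    have e : h (x + T * Complex.I) = Φ (x + T * Complex.I) - r / (x + T * Complex.I - w) := by
      rw [hΦ _ h1 h2 hne]; ring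
    rw [e]
    refine (norm_sub_le _ _).trans (add_le_add ?_ ?_)
    · simpa using hC _ h1 h2 (by simpa using hT)
    · rw [norm_div]
      refine div_le_div_of_nonneg_left (norm_nonneg _) hT0 ?_
      simpa using Complex.abs_im_le_norm ((x : ℂ) + T * Complex.I - w)
  have hlim : Tendsto (fun T : ℝ => 2 * ((C / T ^ 2 + ‖r‖ / |T|) * |b - a|)) atTop (𝓝 0) := by
    have h1 : Tendsto (fun T : ℝ => C / T ^ 2) atTop (𝓝 0) :=
      tendsto_const_nhds.div_atTop (tendsto_pow_atTop two_ne_zero)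
    have h2 : Tendsto (fun T : ℝ => ‖r‖ / |T|) atTop (𝓝 0) :=
      tendsto_const_nhds.div_atTop tendsto_abs_atTop_atTop
    simpa using ((h1.add h2).mul_const |b - a|).const_mul 2
  refine squeeze_zero_norm' ?_ hlim
  filter_upwards [eventually_ge_atTop 1] with T hT
  have hrect := Complex.integral_boundary_rect_eq_zero_of_differentiableOn h
    ((a : ℂ) + (-T : ℝ) * Complex.I) ((b : ℂ) + T * Complex.I) (hd.mono (by
      rintro s ⟨hs, -⟩
      simp only [mem_preimage, Complex.add_re, Complex.ofReal_re, Complex.mul_re, Complex.I_re,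
        mul_zero, Complex.ofReal_im, Complex.I_im, mul_one, sub_self, add_zero, uIcc_of_le hab] at hs
      exact ⟨ha.trans_le hs.1, hs.2.trans_lt hb⟩))
  simp only [Complex.add_re, Complex.ofReal_re, Complex.mul_re, Complex.I_re,
        mul_zero, Complex.ofReal_im, Complex.I_im, mul_one, sub_self, add_zero, Complex.add_im,
        Complex.mul_im, zero_add, smul_eq_mul] at hrect
  have e : (∫ y in (-T)..T, h (b + y * Complex.I)) - ∫ y in (-T)..T, h (a + y * Complex.I)
      = Complex.I * ((∫ x in a..b, h (x + (-T : ℝ) * Complex.I))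
        - ∫ x in a..b, h (x + T * Complex.I)) := by
    have := congrArg (fun z => Complex.I * z) hrect
    simp only [mul_zero] at this
    linear_combination -this + ((∫ y in (-T)..T, h (b + y * Complex.I))
      - ∫ y in (-T)..T, h (a + y * Complex.I)) * Complex.I_sq
  rw [e, norm_mul, Complex.norm_I, one_mul]
  refine (norm_sub_le _ _).trans ?_
  have h1 := hbd T (by rw [abs_of_nonneg] <;> linarith)
  have h2 := hbd (-T) (by rw [abs_neg, abs_of_nonneg] <;> linarith)
  rw [abs_neg, neg_sq] at h2
  linarith

lemma tendsto_truncated {a : ℝ} {g : ℝ → ℂ} (hg : Integrable g)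
    (hΦ : (fun y : ℝ => Φ (a + y * Complex.I)) =ᵐ[volume] g) :
    Tendsto (fun T : ℝ => ∫ y in (-T)..T, g y) atTop
      (𝓝 (2 * Real.pi * verticalIntegral a Φ)) := by
  have h := intervalIntegral_tendsto_integral hg tendsto_neg_atTop_atBot tendsto_id
  have hpi : (Real.pi : ℂ) ≠ 0 := by exact_mod_cast Real.pi_ne_zero
  have e : 2 * Real.pi * verticalIntegral a Φ = ∫ y, g y := by
    unfold verticalIntegral
    rw [integral_mul_const, integral_congr_ae hΦ]
    field_simp
  rw [e]
  exact h

/-- The polar part decays only like `1 / |y|` and is not absolutely integrable, so regular and polar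
parts are separated on symmetric truncations. The regular parts cancel in the limit, and the polar
part contributes `r (π - (-π)) = 2π r`. -/
lemma verticalIntegral_sub (H : SimplePoleStrip Φ α β w r) {a b : ℝ} (ha : α < a) (haw : a < w)
    (hwb : w < b) (hb : b < β) : verticalIntegral b Φ - verticalIntegral a Φ = r := by
  obtain ⟨h, hd, hΦ, hl⟩ := H.exists_line
  have hab := haw.trans hwb
  have la := hl a ha (hab.trans hb) (Or.inl haw.ne)
  have lb := hl b (ha.trans hab) hb (Or.inl hwb.ne')
  have t := (tendsto_truncated lb.2 lb.1).sub (tendsto_truncated la.2 la.1)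
  have t0 := H.tendsto_rectangle hd hΦ ha hab.le hb
  have tb := (tendsto_intervalIntegral_inv_add_mul_I_of_pos (sub_pos.mpr hwb)).const_mul r
  have ta := (tendsto_intervalIntegral_inv_add_mul_I_of_neg (sub_neg.mpr haw)).const_mul r
  have hci : ∀ c : ℝ, α < c → c < β → c ≠ w → ∀ T : ℝ,
      (∫ y in (-T)..T, (h (c + y * Complex.I) + r / (c + y * Complex.I - w)))
        = (∫ y in (-T)..T, h (c + y * Complex.I))
          + r * ∫ y in (-T)..T, (((c - w : ℝ) : ℂ) + y * Complex.I)⁻¹ := by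
    intro c h1 h2 h3 T
    have c1 : Continuous fun y : ℝ => h (c + y * Complex.I) :=
      hd.continuousOn.comp_continuous (by fun_prop) (fun y => by simp [h1, h2])
    have c2 : Continuous fun y : ℝ => (((c - w : ℝ) : ℂ) + y * Complex.I)⁻¹ := by
      refine Continuous.inv₀ (by fun_prop) fun y e => h3 ?_
      have := congrArg Complex.re e
      simp at this
      linarith
    have c3 : Continuous fun y : ℝ => r * (((c - w : ℝ) : ℂ) + y * Complex.I)⁻¹ :=
      continuous_const.mul c2
    rw [← intervalIntegral.integral_const_mul, ← intervalIntegral.integral_add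
      (c1.intervalIntegrable _ _) (c3.intervalIntegrable _ _)]
    refine intervalIntegral.integral_congr fun y _ => ?_
    simp only [div_eq_mul_inv]
    congr 3
    push_cast; ring
  have t1 := t0.add (tb.sub ta)
  have := tendsto_nhds_unique t (t1.congr fun T => by
    rw [hci b (ha.trans hab) hb hwb.ne', hci a ha (hab.trans hb) haw.ne]; ring)
  have hpi : (Real.pi : ℂ) ≠ 0 := by exact_mod_cast Real.pi_ne_zero
  have h2 : (2 * Real.pi : ℂ) * (verticalIntegral b Φ - verticalIntegral a Φ - r) = 0 := by
    linear_combination this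
  have := (mul_eq_zero.mp h2).resolve_left (by simp [hpi])
  linear_combination this

lemma verticalIntegral_eq_of_le (H : SimplePoleStrip Φ α β w 0) {a b : ℝ} (ha : α < a)
    (hab : a ≤ b) (hb : b < β) : verticalIntegral a Φ = verticalIntegral b Φ := by
  obtain ⟨h, hd, hΦ, hl⟩ := H.exists_line
  have la := hl a ha (hab.trans_lt hb) (Or.inr rfl)
  have lb := hl b (ha.trans_le hab) hb (Or.inr rfl)
  have t := (tendsto_truncated lb.2 lb.1).sub (tendsto_truncated la.2 la.1)
  have t0 := H.tendsto_rectangle hd hΦ ha hab hb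
  have := tendsto_nhds_unique t (t0.congr fun T => by simp)
  have hpi : (Real.pi : ℂ) ≠ 0 := by exact_mod_cast Real.pi_ne_zero
  have h2 : (2 * Real.pi : ℂ) * (verticalIntegral a Φ - verticalIntegral b Φ) = 0 := by
    linear_combination -this
  exact sub_eq_zero.mp ((mul_eq_zero.mp h2).resolve_left (by simp [hpi]))

lemma verticalIntegral_eq (H : SimplePoleStrip Φ α β w 0) {a b : ℝ} (ha : α < a) (ha' : a < β)
    (hb : α < b) (hb' : b < β) : verticalIntegral a Φ = verticalIntegral b Φ := by
  rcases le_total a b with hab | hab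
  · exact H.verticalIntegral_eq_of_le ha hab hb'
  · exact (H.verticalIntegral_eq_of_le hb hab ha').symm

end SimplePoleStrip

/-! ### Polynomial growth of the Riemann zeta function in vertical strips -/

/-- For `a ≤ σ ≤ b` one has `t^(σ-1) ≤ t^(a-1) + t^(b-1)`, by comparing `t` with `1`. -/
lemma exists_norm_mellin_le {f : ℝ → ℂ} {a b : ℝ} (ha : MellinConvergent f a)
    (hb : MellinConvergent f b) :
    ∃ C : ℝ, ∀ s : ℂ, a ≤ s.re → s.re ≤ b → ‖mellin f s‖ ≤ C := by
  refine ⟨∫ t in Ioi (0 : ℝ), (‖(t : ℂ) ^ ((a : ℂ) - 1) • f t‖ + ‖(t : ℂ) ^ ((b : ℂ) - 1) • f t‖),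
    fun s h1 h2 => ?_⟩
  refine norm_integral_le_of_norm_le (ha.norm.add hb.norm) ?_
  filter_upwards [ae_restrict_mem measurableSet_Ioi] with t (ht : 0 < t)
  simp only [norm_smul, Complex.norm_cpow_eq_rpow_re_of_pos ht, Complex.sub_re, Complex.ofReal_re,
    Complex.one_re]
  rw [← add_mul]
  refine mul_le_mul_of_nonneg_right ?_ (norm_nonneg _)
  have p1 : 0 ≤ t ^ (a - 1) := by positivity
  have p2 : 0 ≤ t ^ (b - 1) := by positivity
  rcases le_total t 1 with h | h
  · have := Real.rpow_le_rpow_of_exponent_ge ht h (sub_le_sub_right h1 1)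
    linarith
  · have := Real.rpow_le_rpow_of_exponent_le h (sub_le_sub_right h2 1)
    linarith

/-! ### Bounds for sine, cosine and the Gamma function -/

lemma Complex.norm_cos_le_exp_abs_im (z : ℂ) : ‖Complex.cos z‖ ≤ Real.exp |z.im| := by
  have h1 : ‖Complex.exp (z * I)‖ ≤ Real.exp |z.im| := by
    rw [Complex.norm_exp]; simpa using neg_le_abs _
  have h2 : ‖Complex.exp (-z * I)‖ ≤ Real.exp |z.im| := by
    rw [Complex.norm_exp]; simpa using le_abs_self _
  rw [Complex.cos, norm_div, Complex.norm_two, div_le_iff₀ two_pos]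
  exact (norm_add_le _ _).trans (by linarith)

lemma Complex.norm_sin_le_exp_abs_im (z : ℂ) : ‖Complex.sin z‖ ≤ Real.exp |z.im| := by
  have h := Complex.norm_cos_le_exp_abs_im (Real.pi / 2 - z)
  rw [Complex.cos_pi_div_two_sub] at h
  have e : ((Real.pi / 2 : ℂ) - z).im = -z.im := by
    rw [Complex.sub_im]
    have : ((Real.pi : ℂ) / 2).im = 0 := by
      exact_mod_cast Complex.ofReal_im (Real.pi / 2)
    rw [this, zero_sub]
  rwa [e, abs_neg] at h

lemma Complex.Gamma_add_nat_eq_prod {z : ℂ} {n : ℕ} (h : ∀ j < n, z + j ≠ 0) :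
    Complex.Gamma (z + n) = (∏ j ∈ Finset.range n, (z + j)) * Complex.Gamma z := by
  induction n with
  | zero => simp
  | succ n ih =>
    rw [Finset.prod_range_succ, Nat.cast_succ, ← add_assoc, Complex.Gamma_add_one _ (h n (by simp)),
      ih fun j hj => h j (by omega)]
    ring

lemma Complex.norm_Gamma_le_of_re_pos {z : ℂ} (hz : 0 < z.re) :
    ‖Complex.Gamma z‖ ≤ Real.Gamma z.re := by
  rw [Complex.Gamma_eq_integral hz, Real.Gamma_eq_integral hz, Complex.GammaIntegral]
  refine norm_integral_le_of_norm_le (Real.GammaIntegral_convergent hz) ?_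
  filter_upwards [ae_restrict_mem measurableSet_Ioi] with t (ht : 0 < t)
  rw [norm_mul, Complex.norm_cpow_eq_rpow_re_of_pos ht]
  rw [Complex.norm_real, Real.norm_of_nonneg (Real.exp_pos _).le]
  simp

/-- By reflection `1 / Γ(w) = Γ(1 - w) sin(πw) / π`, where `Re (1 - w)` stays in the compact
interval `[1/4, 1 - a]`. -/
lemma Complex.exists_norm_inv_Gamma_le (a : ℝ) : ∃ C : ℝ, 0 ≤ C ∧ ∀ w : ℂ, a ≤ w.re →
    w.re ≤ 3 / 4 → ‖(Complex.Gamma w)⁻¹‖ ≤ C * Real.exp (Real.pi * |w.im|) := by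
  have hc : ContinuousOn Real.Gamma (Icc (1 / 4) (1 - a)) := fun x hx =>
    (Real.differentiableAt_Gamma fun m => by
      have : (0 : ℝ) ≤ m := m.cast_nonneg
      linarith [hx.1]).continuousAt.continuousWithinAt
  obtain ⟨B, hB⟩ := isCompact_Icc.exists_bound_of_continuousOn hc
  refine ⟨|B|, abs_nonneg _, fun w h1 h2 => ?_⟩
  have hre : (1 - w).re = 1 - w.re := by simp
  have hG := (Complex.norm_Gamma_le_of_re_pos (z := 1 - w) (by rw [hre]; linarith)).trans
    ((le_abs_self _).trans (hB _ (by rw [hre]; constructor <;> linarith)))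
  have hne : Complex.Gamma (1 - w) ≠ 0 :=
    Complex.Gamma_ne_zero_of_re_pos (by rw [hre]; linarith)
  have hpi : (Real.pi : ℂ) ≠ 0 := by exact_mod_cast Real.pi_ne_zero
  have e : (Complex.Gamma w)⁻¹ = Complex.Gamma (1 - w) * Complex.sin (Real.pi * w) / Real.pi := by
    have h := Complex.Gamma_mul_Gamma_one_sub w
    by_cases hs : Complex.sin (Real.pi * w) = 0
    · rw [hs, div_zero] at h
      rw [hs, (mul_eq_zero.mp h).resolve_right hne]
      simp
    · have hw : Complex.Gamma w ≠ 0 := by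
        intro h0
        rw [h0, zero_mul] at h
        exact div_ne_zero hpi hs h.symm
      rw [eq_div_iff hs] at h
      rw [inv_eq_one_div, div_eq_div_iff hw hpi]
      linear_combination -h
  rw [e, norm_div, norm_mul]
  have hs := Complex.norm_sin_le_exp_abs_im (Real.pi * w)
  have him : (Real.pi * w : ℂ).im = Real.pi * w.im := by simp
  rw [him, abs_mul, abs_of_pos Real.pi_pos] at hs
  have hpi1 : 1 ≤ ‖(Real.pi : ℂ)‖ := by
    rw [Complex.norm_real, Real.norm_of_nonneg Real.pi_pos.le]; linarith [Real.pi_gt_three]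
  refine (div_le_self (by positivity) hpi1).trans ?_
  exact mul_le_mul (hG.trans (le_abs_self _)) hs (norm_nonneg _) (abs_nonneg _)

/-- On this line `1 - z` is the conjugate of `z`, so reflection gives `|Γ|² = π / cosh(πy)` exactly.
This decay is what offsets the growth of the cosine in the functional equation of `ζ`. -/
lemma Complex.norm_Gamma_half_add_mul_I_le (y : ℝ) :
    ‖Complex.Gamma (1 / 2 + y * Complex.I)‖ ≤
      Real.sqrt (2 * Real.pi) * Real.exp (-(Real.pi * |y| / 2)) := by
  have h := Complex.Gamma_mul_Gamma_one_sub (1 / 2 + y * Complex.I)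
  have e1 : (1 : ℂ) - (1 / 2 + y * Complex.I) =
      (starRingEnd ℂ) (1 / 2 + y * Complex.I) := by
    simp [Complex.ext_iff]; norm_num
  have e2 : Complex.sin (Real.pi * (1 / 2 + y * Complex.I)) = (Real.cosh (Real.pi * y) : ℝ) := by
    rw [show (Real.pi : ℂ) * (1 / 2 + y * Complex.I) = Real.pi / 2 - -(((Real.pi * y : ℝ) : ℂ) *
      Complex.I) by push_cast; ring, Complex.sin_pi_div_two_sub, Complex.cos_neg,
      Complex.cos_mul_I, Complex.ofReal_cosh]
  rw [e1, Complex.Gamma_conj, Complex.mul_conj, e2, ← Complex.ofReal_div, Complex.ofReal_inj,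
    Complex.normSq_eq_norm_sq] at h
  have hcosh : Real.exp (Real.pi * |y|) / 2 ≤ Real.cosh (Real.pi * y) := by
    rw [← Real.cosh_abs, abs_mul, abs_of_pos Real.pi_pos, Real.cosh_eq]
    linarith [Real.exp_pos (-(Real.pi * |y|))]
  refine le_of_sq_le_sq ?_ (by positivity)
  rw [h, mul_pow, Real.sq_sqrt (by positivity), ← Real.exp_nat_mul]
  have : ((2 : ℕ) : ℝ) * -(Real.pi * |y| / 2) = -(Real.pi * |y|) := by push_cast; ring
  rw [this, Real.exp_neg, ← div_eq_mul_inv, mul_comm 2 Real.pi, mul_div_assoc]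
  rw [div_eq_mul_inv]
  refine mul_le_mul_of_nonneg_left ?_ Real.pi_pos.le
  rw [inv_le_comm₀ (Real.cosh_pos _) (by positivity), inv_div]
  exact hcosh

lemma exists_norm_riemannZeta_le_of_three_halves_le :
    ∃ B : ℝ, 0 ≤ B ∧ ∀ z : ℂ, 3 / 2 ≤ z.re → ‖riemannZeta z‖ ≤ B := by
  have hsum : Summable fun n : ℕ => 1 / ((n : ℝ) + 1) ^ (3 / 2 : ℝ) := by
    have := (summable_nat_add_iff 1).mpr
      (Real.summable_one_div_nat_rpow (p := 3 / 2).mpr (by norm_num))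
    simpa using this
  refine ⟨∑' n : ℕ, 1 / ((n : ℝ) + 1) ^ (3 / 2 : ℝ), tsum_nonneg fun n => by positivity,
    fun z hz => ?_⟩
  rw [zeta_eq_tsum_one_div_nat_add_one_cpow (by linarith)]
  refine tsum_of_norm_bounded hsum.hasSum fun n => ?_
  have hn : (0 : ℝ) < (n : ℝ) + 1 := by positivity
  have : ((n : ℂ) + 1) = (((n : ℝ) + 1 : ℝ) : ℂ) := by push_cast; rfl
  rw [norm_div, norm_one, this, Complex.norm_cpow_eq_rpow_re_of_pos hn]
  refine one_div_le_one_div_of_le (by positivity) ?_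
  exact Real.rpow_le_rpow_of_exponent_le (by linarith [(n.cast_nonneg : (0 : ℝ) ≤ n)]) hz

/-- The functional equation carries this line to `Re s = K + 1/2`, where `ζ` is bounded. There
`Γ(s)` is `Γ(1/2 + iy)` times a product of `K` linear factors, and its exponential decay cancels the
growth of `cos(πs/2)`. -/
lemma exists_norm_riemannZeta_le_of_re_eq (K : ℕ) (hK : 1 ≤ K) :
    ∃ C : ℝ, 0 ≤ C ∧ ∀ z : ℂ, z.re = 1 / 2 - K → ‖riemannZeta z‖ ≤ C * (K + |z.im|) ^ K := by
  obtain ⟨B, hB0, hB⟩ := exists_norm_riemannZeta_le_of_three_halves_le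
  refine ⟨2 * Real.sqrt (2 * Real.pi) * B, by positivity, fun z hz => ?_⟩
  have hK' : (1 : ℝ) ≤ K := by exact_mod_cast hK
  set y : ℝ := -z.im with hy
  set s : ℂ := 1 / 2 + y * Complex.I + K with hs
  have hsre : s.re = K + 1 / 2 := by simp [hs]; ring
  have hsim : s.im = y := by simp [hs]
  have hz' : z = 1 - s := by
    apply Complex.ext
    · rw [Complex.sub_re, hsre, hz]; simp; ring
    · rw [Complex.sub_im, hsim, hy]; simp
  have hpos : 0 < s.re := by rw [hsre]; linarith
  rw [hz', riemannZeta_one_sub (fun n h => by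
      have := congrArg Complex.re h
      simp at this
      linarith [(n.cast_nonneg : (0 : ℝ) ≤ n)]) (fun h => by
      have := congrArg Complex.re h
      rw [hsre, Complex.one_re] at this
      linarith)]
  have n1 : ‖(2 * (Real.pi : ℂ)) ^ (-s)‖ ≤ 1 := by
    rw [show (2 * (Real.pi : ℂ)) = ((2 * Real.pi : ℝ) : ℂ) by push_cast; rfl,
      Complex.norm_cpow_eq_rpow_re_of_pos (by positivity)]
    exact Real.rpow_le_one_of_one_le_of_nonpos (by linarith [Real.pi_gt_three])
      (by rw [Complex.neg_re]; linarith)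
  have n2 : ‖Complex.Gamma s‖ ≤ (K + |y|) ^ K *
      (Real.sqrt (2 * Real.pi) * Real.exp (-(Real.pi * |y| / 2))) := by
    rw [hs, Complex.Gamma_add_nat_eq_prod (fun j _ h => by
      have := congrArg Complex.re h
      simp at this
      linarith [(j.cast_nonneg : (0 : ℝ) ≤ j)]), norm_mul]
    refine mul_le_mul ?_ (Complex.norm_Gamma_half_add_mul_I_le y) (norm_nonneg _) (by positivity)
    rw [norm_prod]
    calc _ ≤ ∏ j ∈ Finset.range K, ((K : ℝ) + |y|) := by
          refine Finset.prod_le_prod (fun _ _ => norm_nonneg _) fun j hj => ?_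
          have hj : (j : ℝ) + 1 ≤ K := by exact_mod_cast Finset.mem_range.mp hj
          have e : (1 / 2 : ℂ) + y * Complex.I + j = ((1 / 2 + j : ℝ) : ℂ) + y * Complex.I := by
            push_cast; ring
          rw [e]
          refine (norm_add_le _ _).trans ?_
          rw [Complex.norm_real, norm_mul, Complex.norm_real, Complex.norm_I,
            Real.norm_of_nonneg (by positivity), Real.norm_eq_abs]
          linarith
      _ = _ := by simp
  have n3 : ‖Complex.cos (Real.pi * s / 2)‖ ≤ Real.exp (Real.pi * |y| / 2) := by
    have h := Complex.norm_cos_le_exp_abs_im (Real.pi * s / 2)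
    have e : (Real.pi * s / 2 : ℂ).im = Real.pi * y / 2 := by
      rw [show (Real.pi * s / 2 : ℂ) = ((Real.pi / 2 : ℝ) : ℂ) * s by push_cast; ring,
        Complex.im_ofReal_mul, hsim]
      ring
    rw [e] at h
    rwa [abs_div, abs_mul, abs_of_pos Real.pi_pos, abs_of_pos (two_pos : (0 : ℝ) < 2)] at h
  have n4 := hB s (by rw [hsre]; linarith)
  have hyy : |(1 - s).im| = |y| := by rw [Complex.sub_im, hsim]; simp
  rw [hyy, norm_mul, norm_mul, norm_mul, norm_mul, Complex.norm_two]
  calc _ ≤ 2 * 1 * ((K + |y|) ^ K * (Real.sqrt (2 * Real.pi) *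
        Real.exp (-(Real.pi * |y| / 2)))) * Real.exp (Real.pi * |y| / 2) * B := by
        gcongr
    _ = 2 * Real.sqrt (2 * Real.pi) * B * (K + |y|) ^ K *
        (Real.exp (-(Real.pi * |y| / 2)) * Real.exp (Real.pi * |y| / 2)) := by ring
    _ = _ := by rw [← Real.exp_add]; simp

/-- By definition this function is half the Mellin transform, at `z / 2`, of a modified theta kernel
whose Mellin integral converges for every exponent. -/
lemma exists_norm_completedRiemannZeta₀_le (a b : ℝ) :
    ∃ C : ℝ, ∀ z : ℂ, a ≤ z.re → z.re ≤ b → ‖completedRiemannZeta₀ z‖ ≤ C := by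
  have hm : ∀ s : ℂ, MellinConvergent (HurwitzZeta.hurwitzEvenFEPair 0).f_modif s := fun s =>
    ((HurwitzZeta.hurwitzEvenFEPair 0).isStrongFEPair_toStrongFEPair.hasMellin s).1
  obtain ⟨C, hC⟩ := exists_norm_mellin_le (hm (a / 2 : ℝ)) (hm (b / 2 : ℝ))
  refine ⟨C / 2, fun z h1 h2 => ?_⟩
  have e : completedRiemannZeta₀ z =
      mellin (HurwitzZeta.hurwitzEvenFEPair 0).f_modif (z / 2) / 2 := rfl
  rw [e, norm_div, Complex.norm_two]
  have hre : (z / 2).re = z.re / 2 := by simp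
  have := hC (z / 2) (by rw [hre]; linarith) (by rw [hre]; linarith)
  linarith

/-- A crude bound, needed only as the a priori growth hypothesis of the Phragmén–Lindelöf principle.
It comes from writing `ζ` as the completed zeta function divided by `π^(-z/2) Γ(z/2)`. -/
lemma exists_norm_riemannZeta_le_exp (a : ℝ) :
    ∃ C : ℝ, 0 ≤ C ∧ ∀ z : ℂ, a ≤ z.re → z.re ≤ 3 / 2 → 1 ≤ |z.im| →
      ‖riemannZeta z‖ ≤ C * Real.exp (Real.pi / 2 * |z.im|) := by
  obtain ⟨C1, h1⟩ := exists_norm_completedRiemannZeta₀_le a (3 / 2)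
  obtain ⟨C2, hC2, h2⟩ := Complex.exists_norm_inv_Gamma_le (a / 2)
  refine ⟨(|C1| + 2) * (Real.pi ^ (3 / 4 : ℝ) * C2), by positivity, fun z hza hzb hz => ?_⟩
  have hz0 : z ≠ 0 := by rintro rfl; simp at hz; linarith
  have b1 : ‖completedRiemannZeta₀ z - 1 / z - 1 / (1 - z)‖ ≤ |C1| + 2 := by
    have i1 : ‖1 / z‖ ≤ 1 := by
      rw [norm_div, norm_one, div_le_one (norm_pos_iff.mpr hz0)]
      exact hz.trans (Complex.abs_im_le_norm z)
    have i2 : ‖1 / (1 - z)‖ ≤ 1 := by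
      have h : 1 ≤ ‖1 - z‖ := by
        have := Complex.abs_im_le_norm (1 - z)
        rw [Complex.sub_im, Complex.one_im, zero_sub, abs_neg] at this
        exact hz.trans this
      rw [norm_div, norm_one, div_le_one (by linarith)]
      exact h
    have := norm_sub_le (completedRiemannZeta₀ z - 1 / z) (1 / (1 - z))
    have := norm_sub_le (completedRiemannZeta₀ z) (1 / z)
    have := (h1 z hza hzb).trans (le_abs_self _)
    linarith
  have hre : (z / 2).re = z.re / 2 := by simp
  have him : (z / 2).im = z.im / 2 := by simp
  have b2 := h2 (z / 2) (by rw [hre]; linarith) (by rw [hre]; linarith)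
  rw [him, abs_div, abs_of_pos (two_pos : (0 : ℝ) < 2)] at b2
  have b3 : ‖((Real.pi : ℂ) ^ (-z / 2))⁻¹‖ ≤ Real.pi ^ (3 / 4 : ℝ) := by
    rw [← Complex.cpow_neg, Complex.norm_cpow_eq_rpow_re_of_pos Real.pi_pos]
    refine Real.rpow_le_rpow_of_exponent_le (by linarith [Real.pi_gt_three]) ?_
    rw [show -(-z / 2) = z / 2 by ring, hre]
    linarith
  rw [riemannZeta_eq_completedRiemannZeta₀ hz0, div_eq_mul_inv, mul_inv, norm_mul, norm_mul]
  calc _ ≤ (|C1| + 2) * (Real.pi ^ (3 / 4 : ℝ) * (C2 * Real.exp (Real.pi * (|z.im| / 2)))) := by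
        gcongr
    _ = _ := by rw [show Real.pi * (|z.im| / 2) = Real.pi / 2 * |z.im| by ring]; ring

/-- The Riemann zeta function has polynomial growth in right half-planes. -/
theorem exists_norm_riemannZeta_le_pow (a : ℝ) :
    ∃ (m : ℕ) (C : ℝ), 0 ≤ C ∧ ∀ z : ℂ, a ≤ z.re → 1 ≤ |z.im| →
      ‖riemannZeta z‖ ≤ C * |z.im| ^ m := by
  obtain ⟨K, hK⟩ := exists_nat_ge (1 / 2 - a)
  replace hK : 1 / 2 - ((K + 1 : ℕ) : ℝ) ≤ a := by push_cast; linarith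
  have hK1 : 1 ≤ K + 1 := by omega
  generalize K + 1 = K at hK hK1
  have hK2 : (1 : ℝ) ≤ K := by exact_mod_cast hK1
  obtain ⟨B, hB0, hB⟩ := exists_norm_riemannZeta_le_of_three_halves_le
  obtain ⟨C1, hC10, hC1⟩ := exists_norm_riemannZeta_le_of_re_eq K hK1
  obtain ⟨C2, hC20, hC2⟩ := exists_norm_riemannZeta_le_exp (1 / 2 - K)
  have hζ₁ : ∀ z : ℂ, z ≠ 1 → riemannZeta₁ z = (z - 1) * riemannZeta z := fun z hz => by
    rw [riemannZeta_eq_inv_sub_mul hz, mul_inv_cancel_left₀ (sub_ne_zero.mpr hz)]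
  have hne2 : ∀ z : ℂ, z.re ≤ 3 / 2 → 1 / 2 ≤ ‖z - 2‖ := fun z hz => by
    have h := Complex.abs_re_le_norm (z - 2)
    have : (z - 2).re = z.re - 2 := by simp
    rw [this, abs_of_neg (by linarith)] at h
    linarith
  have hle : ∀ z : ℂ, z.re ≤ 3 / 2 → ‖z - 1‖ ≤ 3 * ‖z - 2‖ := fun z hz => by
    have h := norm_add_le (z - 2) 1
    rw [show z - 2 + 1 = z - 1 by ring, norm_one] at h
    linarith [hne2 z hz]
  have hnorm : ∀ z : ℂ, z.re ≤ 3 / 2 → z ≠ 1 → ∀ D : ℝ, ‖riemannZeta z‖ ≤ D * ‖z - 2‖ ^ K →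
      ‖riemannZeta₁ z / (z - 2) ^ (K + 1)‖ ≤ 3 * D := by
    intro z hz hz1 D hD
    have hp : 0 < ‖z - 2‖ := by linarith [hne2 z hz]
    rw [norm_div, norm_pow, div_le_iff₀ (by positivity), hζ₁ z hz1, norm_mul]
    calc _ ≤ (3 * ‖z - 2‖) * (D * ‖z - 2‖ ^ K) :=
          mul_le_mul (hle z hz) hD (norm_nonneg _) (by positivity)
      _ = _ := by ring
  have hone : ∀ z : ℂ, z.re ≤ 3 / 2 → 1 ≤ 2 ^ K * ‖z - 2‖ ^ K := fun z hz => by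
    rw [← mul_pow]
    exact one_le_pow₀ (by linarith [hne2 z hz])
  set M : ℝ := 3 * (B * 2 ^ K) + 3 * (C1 * 2 ^ K) with hM
  -- The entire function `riemannZeta₁ z = (z - 1) ζ(z)` has no pole, and dividing by `(z - 2) ^ (K
  -- + 1)` compensates the factor `z - 1` and the degree `K` growth on the left edge. The point `2`
  -- lies to the right of the strip.
  have hPL : ∀ z : ℂ, 1 / 2 - K ≤ z.re → z.re ≤ 3 / 2 →
      ‖riemannZeta₁ z / (z - 2) ^ (K + 1)‖ ≤ M := by
    intro z hz1 hz2
    refine PhragmenLindelof.vertical_strip (a := 1 / 2 - K) (b := 3 / 2)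
      (f := fun z => riemannZeta₁ z / (z - 2) ^ (K + 1)) ?_ ?_ ?_ ?_ hz1 hz2
    · have hd : DifferentiableOn ℂ (fun z => riemannZeta₁ z / (z - 2) ^ (K + 1))
          {z : ℂ | z.re < 2} := by
        refine differentiable_riemannZeta₁.differentiableOn.div (by fun_prop) fun z hz => ?_
        refine pow_ne_zero _ (sub_ne_zero.mpr ?_)
        rintro rfl
        simp at hz
      refine (hd.mono ?_).diffContOnCl
      intro z hz
      rw [Complex.closure_preimage_re] at hz
      have hz := closure_minimal Ioo_subset_Icc_self isClosed_Icc hz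
      exact lt_of_le_of_lt hz.2 (by norm_num)
    -- Half the critical exponent `π / width`. The factor `π / 2 / c` below makes `π / 2 / c * exp
    -- (c |y|)` dominate `π / 2 * |y|`.
    · set c : ℝ := Real.pi / (3 / 2 - (1 / 2 - K)) / 2 with hc
      have hcpos : 0 < c := by
        have : 0 < 3 / 2 - (1 / 2 - (K : ℝ)) := by linarith
        positivity
      refine ⟨c, by rw [hc] at hcpos ⊢; linarith, Real.pi / 2 / c, ?_⟩
      refine Asymptotics.IsBigO.of_bound (3 * (C2 * 2 ^ K)) ?_
      have hev : ∀ᶠ z : ℂ in comap (_root_.abs ∘ Complex.im) atTop ⊓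
          𝓟 (Complex.re ⁻¹' Ioo (1 / 2 - (K : ℝ)) (3 / 2)), 1 ≤ |z.im| ∧
            z ∈ Complex.re ⁻¹' Ioo (1 / 2 - (K : ℝ)) (3 / 2) :=
        (Filter.Eventually.filter_mono inf_le_left
          (tendsto_comap.eventually (eventually_ge_atTop 1))).and
          (Filter.Eventually.filter_mono inf_le_right (eventually_principal.mpr fun _ h => h))
      filter_upwards [hev] with z hz
      have hz1 : z ≠ 1 := by rintro rfl; simp at hz; linarith [hz.1]
      have h := hC2 z hz.2.1.le hz.2.2.le hz.1
      have hE : Real.exp (Real.pi / 2 * |z.im|) ≤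
          Real.exp (Real.pi / 2 / c * Real.exp (c * |z.im|)) := by
        refine Real.exp_le_exp.mpr ?_
        have h1 := (Real.add_one_le_exp (c * |z.im|))
        calc Real.pi / 2 * |z.im| = Real.pi / 2 / c * (c * |z.im|) := by field_simp
          _ ≤ _ := by
            refine mul_le_mul_of_nonneg_left (by linarith) ?_
            have := Real.pi_pos
            positivity
      rw [Real.norm_of_nonneg (Real.exp_pos _).le]
      set E := Real.exp (Real.pi / 2 / c * Real.exp (c * |z.im|))
      have hE0 : 0 ≤ E := (Real.exp_pos _).le
      have := hnorm z hz.2.2.le hz1 (C2 * E * 2 ^ K) (by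
        have i1 := hone z hz.2.2.le
        calc _ ≤ C2 * E := h.trans (by gcongr)
          _ ≤ C2 * E * (2 ^ K * ‖z - 2‖ ^ K) := le_mul_of_one_le_right (by positivity) i1
          _ = _ := by ring)
      linarith
    · intro z hz
      have hz2 : z.re ≤ 3 / 2 := by linarith
      have hz1 : z ≠ 1 := by rintro rfl; simp at hz; linarith
      have hw : ((K : ℝ) + |z.im|) ≤ 2 * ‖z - 2‖ := by
        have h1 := Complex.abs_re_le_norm (z - 2)
        have h2 := Complex.abs_im_le_norm (z - 2)
        have e1 : (z - 2).re = z.re - 2 := by simp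
        have e2 : (z - 2).im = z.im := by simp
        rw [e1, abs_of_neg (by linarith)] at h1
        rw [e2] at h2
        linarith
      refine (hnorm z hz2 hz1 (C1 * 2 ^ K) ((hC1 z hz).trans ?_)).trans ?_
      · rw [mul_assoc, ← mul_pow]
        gcongr
      · have : 0 ≤ B * 2 ^ K := by positivity
        linarith
    · intro z hz
      have hz1 : z ≠ 1 := by rintro rfl; norm_num at hz
      refine (hnorm z hz.le hz1 (B * 2 ^ K) ?_).trans ?_
      · calc _ ≤ B := hB z hz.ge
          _ ≤ B * (2 ^ K * ‖z - 2‖ ^ K) := le_mul_of_one_le_right hB0 (hone z hz.le)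
          _ = _ := by ring
      · have : 0 ≤ C1 * 2 ^ K := by positivity
        linarith
  have hM0 : 0 ≤ M := by positivity
  refine ⟨K + 1, B + M * (K + 3) ^ (K + 1), by positivity, fun z hza hz => ?_⟩
  have hp1 : 1 ≤ |z.im| ^ (K + 1) := one_le_pow₀ hz
  rcases le_total (3 / 2) z.re with h | h
  · calc _ ≤ B := hB z h
      _ ≤ (B + M * (K + 3) ^ (K + 1)) * 1 := by
        have : 0 ≤ M * ((K : ℝ) + 3) ^ (K + 1) := by positivity
        linarith
      _ ≤ _ := by gcongr
  · have hz1 : z ≠ 1 := by rintro rfl; simp at hz; linarith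
    have h1 := hPL z (hK.trans hza) h
    have hp : 0 < ‖z - 2‖ := by linarith [hne2 z h]
    rw [norm_div, norm_pow, div_le_iff₀ (by positivity), hζ₁ z hz1, norm_mul] at h1
    have hz1' : 1 ≤ ‖z - 1‖ := by
      have := Complex.abs_im_le_norm (z - 1)
      rw [Complex.sub_im, Complex.one_im, sub_zero] at this
      exact hz.trans this
    have h2 : ‖z - 2‖ ≤ (K + 3) * |z.im| := by
      have i1 := Complex.norm_le_abs_re_add_abs_im (z - 2)
      have e1 : (z - 2).re = z.re - 2 := by simp
      have e2 : (z - 2).im = z.im := by simp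
      rw [e1, e2, abs_of_neg (by linarith)] at i1
      nlinarith
    calc ‖riemannZeta z‖ ≤ ‖z - 1‖ * ‖riemannZeta z‖ :=
          le_mul_of_one_le_left (norm_nonneg _) hz1'
      _ ≤ M * ‖z - 2‖ ^ (K + 1) := h1
      _ ≤ M * ((K + 3) * |z.im|) ^ (K + 1) := by gcongr
      _ = M * (K + 3) ^ (K + 1) * |z.im| ^ (K + 1) := by rw [mul_pow]; ring
      _ ≤ _ := by gcongr; linarith

/-! ### Complex-order derivatives -/

/-- `g n` is, up to the sign `(-1) ^ n`, the `n`-th derivative of `g 0` on `[0, ∞[`, and all the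
`g n` are rapidly decreasing at infinity. -/
structure RapidTower (g : ℕ → ℝ → ℂ) : Prop where
  continuousOn : ∀ n, ContinuousOn (g n) (Ici 0)
  hasDerivAt : ∀ n, ∀ u : ℝ, 0 < u → HasDerivAt (g n) (-(g (n + 1) u)) u
  decay : ∀ m n : ℕ, Tendsto (fun u : ℝ => ((u ^ m : ℝ) : ℂ) * g n u) atTop (𝓝 0)

/-- The entire function which extends `s ↦ (1 / Γ(-s)) ∫_0^∞ u^(-s-1) g 0 u du`. -/
noncomputable def liouvilleExt (g : ℕ → ℝ → ℂ) (s : ℂ) : ℂ :=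
  mellin (g (⌊s.re⌋₊ + 1)) ((⌊s.re⌋₊ + 1 : ℕ) - s) / Complex.Gamma ((⌊s.re⌋₊ + 1 : ℕ) - s)

namespace RapidTower

variable {g : ℕ → ℝ → ℂ}

lemma isBigO_atTop (H : RapidTower g) (n : ℕ) (r : ℝ) :
    g n =O[atTop] (fun u : ℝ => u ^ (-r)) := by
  refine Asymptotics.IsBigO.of_bound 1 ?_
  have h := (H.decay ⌈r⌉₊ n).norm
  rw [norm_zero] at h
  filter_upwards [h.eventually (eventually_le_nhds one_pos), eventually_ge_atTop 1] with u h1 hu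
  have hu0 : 0 < u := by linarith
  rw [norm_mul, Complex.norm_real, Real.norm_of_nonneg (by positivity)] at h1
  rw [one_mul, Real.norm_of_nonneg (by positivity), Real.rpow_neg hu0.le, ← one_div,
    le_div_iff₀ (by positivity)]
  have h2 : u ^ r ≤ u ^ ⌈r⌉₊ := by
    rw [← Real.rpow_natCast]
    exact Real.rpow_le_rpow_of_exponent_le hu (Nat.le_ceil r)
  nlinarith [norm_nonneg (g n u)]

lemma isBigO_zero (H : RapidTower g) (n : ℕ) :
    g n =O[𝓝[>] 0] (fun u : ℝ => u ^ (-(0 : ℝ))) := by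
  simp only [neg_zero, Real.rpow_zero]
  have h : Tendsto (g n) (𝓝[>] 0) (𝓝 (g n 0)) :=
    ((H.continuousOn n) 0 (by simp)).mono_left (nhdsWithin_mono _ Ioi_subset_Ici_self)
  exact h.isBigO_one ℝ

lemma locallyIntegrableOn (H : RapidTower g) (n : ℕ) : LocallyIntegrableOn (g n) (Ioi 0) :=
  ((H.continuousOn n).mono Ioi_subset_Ici_self).locallyIntegrableOn measurableSet_Ioi

lemma mellinConvergent (H : RapidTower g) (n : ℕ) {s : ℂ} (hs : 0 < s.re) :
    MellinConvergent (g n) s :=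
  mellinConvergent_of_isBigO_rpow (H.locallyIntegrableOn n) (H.isBigO_atTop n (s.re + 1))
    (by linarith) (H.isBigO_zero n) hs

lemma differentiableAt_mellin (H : RapidTower g) (n : ℕ) {s : ℂ} (hs : 0 < s.re) :
    DifferentiableAt ℂ (mellin (g n)) s :=
  mellin_differentiableAt_of_isBigO_rpow (H.locallyIntegrableOn n) (H.isBigO_atTop n (s.re + 1))
    (by linarith) (H.isBigO_zero n) hs

lemma tendsto_cpow_mul (H : RapidTower g) (n : ℕ) (z : ℂ) :
    Tendsto (fun u : ℝ => (u : ℂ) ^ z * g n u) atTop (𝓝 0) := by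
  rw [tendsto_zero_iff_norm_tendsto_zero]
  have h : Tendsto (fun u : ℝ => ‖((u ^ ⌈z.re⌉₊ : ℝ) : ℂ) * g n u‖) atTop (𝓝 0) := by
    simpa using (H.decay ⌈z.re⌉₊ n).norm
  refine squeeze_zero' (Eventually.of_forall fun _ => norm_nonneg _) ?_ h
  filter_upwards [eventually_ge_atTop 1] with u hu
  have hu0 : 0 < u := by linarith
  rw [norm_mul, norm_mul, Complex.norm_cpow_eq_rpow_re_of_pos hu0, Complex.norm_real,
    Real.norm_of_nonneg (by positivity)]
  refine mul_le_mul_of_nonneg_right ?_ (norm_nonneg _)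
  rw [← Real.rpow_natCast]
  exact Real.rpow_le_rpow_of_exponent_le hu (Nat.le_ceil _)

/-- Integration by parts: `u^z g n u` vanishes at `0` because `Re z > 0`, and at infinity by rapid
decay. -/
lemma mellin_add_one (H : RapidTower g) (n : ℕ) {z : ℂ} (hz : 0 < z.re) :
    mellin (g (n + 1)) (z + 1) = z * mellin (g n) z := by
  have hz0 : z ≠ 0 := by rintro rfl; simp at hz
  have i1 := (H.mellinConvergent n hz).const_mul z
  have i2 := H.mellinConvergent (n + 1) (s := z + 1) (by simp; linarith)
  rw [MellinConvergent, add_sub_cancel_right] at i2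
  have hd : ∀ u ∈ Ioi (0 : ℝ), HasDerivAt (fun u : ℝ => (u : ℂ) ^ z * g n u)
      (z * ((u : ℂ) ^ (z - 1) • g n u) - (u : ℂ) ^ z • g (n + 1) u) u := by
    intro u hu
    have h1 := (hasDerivAt_ofReal_cpow_const (ne_of_gt hu) hz0).mul (H.hasDerivAt n u hu)
    refine h1.congr_deriv ?_
    simp only [smul_eq_mul]
    ring
  have hc : ContinuousWithinAt (fun u : ℝ => (u : ℂ) ^ z * g n u) (Ici 0) 0 :=
    (Complex.continuousAt_ofReal_cpow_const 0 z (Or.inl hz)).continuousWithinAt.mul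
      (H.continuousOn n 0 (by simp))
  have key := integral_Ioi_of_hasDerivAt_of_tendsto hc hd (i1.sub i2) (H.tendsto_cpow_mul n z)
  rw [integral_sub i1 i2, integral_const_mul] at key
  simp only [Complex.ofReal_zero, Complex.zero_cpow hz0, zero_mul, sub_zero] at key
  rw [mellin, mellin, add_sub_cancel_right]
  linear_combination -key

/-- The limiting case `z = 0` of the integration by parts, where the boundary term at `0` survives.
It yields the values of the extension at the natural numbers. -/
lemma mellin_one (H : RapidTower g) (n : ℕ) : mellin (g (n + 1)) 1 = g n 0 := by
  have i2 := H.mellinConvergent (n + 1) (s := 1) (by simp)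
  simp only [MellinConvergent, sub_self, Complex.cpow_zero, one_smul] at i2
  have key := integral_Ioi_of_hasDerivAt_of_tendsto (H.continuousOn n 0 (by simp))
    (fun u hu => H.hasDerivAt n u hu) i2.neg (by simpa using H.tendsto_cpow_mul n 0)
  rw [integral_neg] at key
  simp only [mellin, sub_self, Complex.cpow_zero, one_smul]
  linear_combination -key

/-- Passing from `n` to `n + 1` multiplies both the Mellin transform and `Γ` by `n - s`. Hence the
quotient is the same for all `n > Re s`, and the jumps of the floor in `liouvilleExt` have no
effect. -/
lemma mellin_div_Gamma_eq_succ (H : RapidTower g) {n : ℕ} {s : ℂ} (hs : s.re < n) :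
    mellin (g (n + 1)) ((n + 1 : ℕ) - s) / Complex.Gamma ((n + 1 : ℕ) - s) =
      mellin (g n) (n - s) / Complex.Gamma (n - s) := by
  have hre : 0 < (n - s).re := by simpa using hs
  have hne : (n : ℂ) - s ≠ 0 := fun h => by rw [h] at hre; simp at hre
  rw [show ((n + 1 : ℕ) : ℂ) - s = n - s + 1 by push_cast; ring, H.mellin_add_one n hre,
    Complex.Gamma_add_one _ hne, mul_div_mul_left _ _ hne]

lemma mellin_div_Gamma_eq_of_le (H : RapidTower g) {n m : ℕ} (hnm : n ≤ m) {s : ℂ}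
    (hs : s.re < n) :
    mellin (g m) (m - s) / Complex.Gamma (m - s) =
      mellin (g n) (n - s) / Complex.Gamma (n - s) := by
  induction m, hnm using Nat.le_induction with
  | base => rfl
  | succ m hm ih =>
    rw [H.mellin_div_Gamma_eq_succ (hs.trans_le (by exact_mod_cast hm)), ih]

lemma liouvilleExt_eq (H : RapidTower g) {n : ℕ} {s : ℂ} (hs : s.re < n) :
    liouvilleExt g s = mellin (g n) (n - s) / Complex.Gamma (n - s) := by
  have h0 : s.re < (⌊s.re⌋₊ + 1 : ℕ) := by exact_mod_cast Nat.lt_floor_add_one s.re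
  rcases le_total n (⌊s.re⌋₊ + 1) with h | h
  · exact H.mellin_div_Gamma_eq_of_le h hs
  · exact (H.mellin_div_Gamma_eq_of_le h h0).symm

lemma differentiable_liouvilleExt (H : RapidTower g) : Differentiable ℂ (liouvilleExt g) := by
  intro s
  obtain ⟨n, hn⟩ := exists_nat_gt s.re
  have hev : ∀ᶠ w in 𝓝 s, liouvilleExt g w =
      mellin (g n) (n - w) * (Complex.Gamma (n - w))⁻¹ := by
    filter_upwards [(Complex.continuous_re.isOpen_preimage _ isOpen_Iio).mem_nhds
      (show s ∈ Complex.re ⁻¹' Iio (n : ℝ) from hn)] with w hw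
    rw [H.liouvilleExt_eq hw, div_eq_mul_inv]
  refine DifferentiableAt.congr_of_eventuallyEq ?_ hev
  have h1 : DifferentiableAt ℂ (fun w : ℂ => (n : ℂ) - w) s := by fun_prop
  refine DifferentiableAt.mul ?_ ?_
  · exact (H.differentiableAt_mellin n (s := n - s) (by simpa using hn)).comp s h1
  · exact (Complex.differentiable_one_div_Gamma _).comp s h1

lemma liouvilleExt_nat (H : RapidTower g) (k : ℕ) : liouvilleExt g k = g k 0 := by
  rw [H.liouvilleExt_eq (n := k + 1) (by simp)]
  simp [H.mellin_one k]

lemma Gamma_mul_liouvilleExt (H : RapidTower g) {n : ℕ} {s : ℂ} (hs : s.re < n)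
    (hne : s.im ≠ 0) :
    (∏ j ∈ Finset.range n, (-s + j)) * (Complex.Gamma (-s) * liouvilleExt g s) =
      mellin (g n) (n - s) := by
  have hG : Complex.Gamma (n - s) ≠ 0 := Complex.Gamma_ne_zero_of_re_pos (by simpa using hs)
  have e := Complex.Gamma_add_nat_eq_prod (z := -s) (n := n) (fun j _ h => hne (by
    simpa using congrArg Complex.im h))
  rw [neg_add_eq_sub] at e
  rw [← mul_assoc, ← e, H.liouvilleExt_eq hs, mul_div_cancel₀ _ hG]

/-- After multiplication by the `n` factors `j - s`, each of modulus at least `|Im s|`, the function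
becomes a Mellin transform bounded in the strip. Since `n` can be taken large, any power of decay is
reached. -/
lemma exists_norm_Gamma_mul_liouvilleExt_le (H : RapidTower g) (α β : ℝ) (k : ℕ) :
    ∃ C : ℝ, 0 ≤ C ∧ ∀ s : ℂ, α ≤ s.re → s.re ≤ β → 1 ≤ |s.im| →
      ‖Complex.Gamma (-s) * liouvilleExt g s‖ ≤ C / |s.im| ^ k := by
  obtain ⟨n, hn⟩ := exists_nat_gt (max (max α β) k)
  have hnα : α < n := lt_of_le_of_lt ((le_max_left _ _).trans (le_max_left _ _)) hn
  have hnβ : β < n := lt_of_le_of_lt ((le_max_right _ _).trans (le_max_left _ _)) hn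
  have hnk : k ≤ n := by exact_mod_cast ((le_max_right _ _).trans_lt hn).le
  obtain ⟨C, hC⟩ := exists_norm_mellin_le
    (H.mellinConvergent n (s := ((n - β : ℝ) : ℂ)) (by rw [Complex.ofReal_re]; linarith))
    (H.mellinConvergent n (s := ((n - α : ℝ) : ℂ)) (by rw [Complex.ofReal_re]; linarith))
  refine ⟨|C|, abs_nonneg _, fun s h1 h2 h3 => ?_⟩
  have him : s.im ≠ 0 := by rintro h; rw [h] at h3; simp at h3; linarith
  have e := congrArg norm (H.Gamma_mul_liouvilleExt (h2.trans_lt hnβ) him)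
  have hre : ((n : ℂ) - s).re = n - s.re := by simp
  have hm := (hC (n - s) (by rw [hre]; linarith) (by rw [hre]; linarith)).trans (le_abs_self _)
  rw [norm_mul, norm_prod] at e
  have hp : |s.im| ^ n ≤ ∏ j ∈ Finset.range n, ‖-s + (j : ℂ)‖ := by
    calc |s.im| ^ n = ∏ j ∈ Finset.range n, |s.im| := by simp
      _ ≤ _ := by
        refine Finset.prod_le_prod (fun _ _ => abs_nonneg _) fun j _ => ?_
        simpa using Complex.abs_im_le_norm (-s + j)
  rw [le_div_iff₀ (by positivity)]
  calc _ ≤ ‖Complex.Gamma (-s) * liouvilleExt g s‖ * |s.im| ^ n := by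
        gcongr
    _ ≤ ‖Complex.Gamma (-s) * liouvilleExt g s‖ * ∏ j ∈ Finset.range n, ‖-s + (j : ℂ)‖ := by
        gcongr
    _ = ‖mellin (g n) (n - s)‖ := by rw [mul_comm, e]
    _ ≤ _ := hm

end RapidTower

/-! ### From functions on the half-line to towers of derivatives -/

lemma IsSchwartzLeft.rapidTower {F : ℝ → ℂ} (hF : IsSchwartzLeft 0 F) {a : ℝ} (ha : a ≤ 0) :
    RapidTower (fun n u => iteratedDerivWithin n F (Iic 0) (a - u)) where
  continuousOn n := by
    refine (hF.smooth.continuousOn_iteratedDerivWithin (by exact_mod_cast le_top)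
      (uniqueDiffOn_Iic 0)).comp (by fun_prop) fun u hu => ?_
    have : 0 ≤ u := hu
    simp only [mem_Iic]
    linarith
  hasDerivAt n u hu := by
    have hlt : a - u < 0 := by linarith
    have h1 := (hF.smooth.differentiableOn_iteratedDerivWithin (m := n)
      (by exact_mod_cast WithTop.coe_lt_top _) (uniqueDiffOn_Iic 0)) (a - u) hlt.le
    have h2 := h1.hasDerivWithinAt.hasDerivAt (Iic_mem_nhds hlt)
    rw [← iteratedDerivWithin_succ] at h2
    have h3 : HasDerivAt (fun u : ℝ => a - u) (-1) u := by
      simpa using (hasDerivAt_id u).const_sub a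
    have h4 := h2.scomp u h3
    rw [neg_one_smul] at h4
    exact h4
  decay m n := by
    have ht : Tendsto (fun u : ℝ => a - u) atTop atBot :=
      tendsto_atBot_add_const_left _ a tendsto_neg_atTop_atBot
    have h := ((hF.decay m n).comp ht).norm
    rw [norm_zero] at h
    rw [tendsto_zero_iff_norm_tendsto_zero]
    refine squeeze_zero' (Eventually.of_forall fun _ => norm_nonneg _) ?_ h
    filter_upwards [eventually_ge_atTop 0] with u hu
    simp only [Function.comp_apply, norm_mul, Complex.norm_real, norm_pow, Real.norm_eq_abs,
      abs_abs]
    refine mul_le_mul_of_nonneg_right ?_ (norm_nonneg _)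
    refine pow_le_pow_left₀ (abs_nonneg _) ?_ m
    rw [abs_of_nonneg hu, abs_of_nonpos (by linarith)]
    linarith

lemma RapidTower.isFracDeriv {g : ℕ → ℝ → ℂ} (H : RapidTower g) {F : ℝ → ℂ} {a : ℝ}
    (h0 : ∀ u, g 0 u = F (a - u)) : IsFracDeriv F a (liouvilleExt g) := by
  refine ⟨H.differentiable_liouvilleExt, fun s hs => ?_⟩
  rw [H.liouvilleExt_eq (n := 0) (by simpa using hs)]
  simp only [mellin, Nat.cast_zero, zero_sub, smul_eq_mul, h0]
  ring

/-- Identity theorem near `-1`, where the integral formula determines both functions. -/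
lemma IsFracDeriv.unique {F : ℝ → ℂ} {a : ℝ} {D₁ D₂ : ℂ → ℂ} (h₁ : IsFracDeriv F a D₁)
    (h₂ : IsFracDeriv F a D₂) : D₁ = D₂ := by
  have a₁ := h₁.1.differentiableOn.analyticOnNhd isOpen_univ
  have a₂ := h₂.1.differentiableOn.analyticOnNhd isOpen_univ
  refine a₁.eq_of_eventuallyEq a₂ (z₀ := -1) ?_
  filter_upwards [(Complex.continuous_re.isOpen_preimage _ isOpen_Iio).mem_nhds
    (show (-1 : ℂ) ∈ Complex.re ⁻¹' Iio (0 : ℝ) by simp)] with s hs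
  rw [h₁.2 s hs, h₂.2 s hs]

lemma IsSchwartzLeft.isFracDeriv {F : ℝ → ℂ} (hF : IsSchwartzLeft 0 F) {a : ℝ} (ha : a ≤ 0) :
    IsFracDeriv F a (liouvilleExt fun n u => iteratedDerivWithin n F (Iic 0) (a - u)) :=
  (hF.rapidTower ha).isFracDeriv fun u => by simp

lemma IsSchwartzLeft.isFracDeriv_fracDeriv {F : ℝ → ℂ} (hF : IsSchwartzLeft 0 F) {a : ℝ}
    (ha : a ≤ 0) : IsFracDeriv F a (fracDeriv F a) :=
  Classical.epsilon_spec (p := IsFracDeriv F a) ⟨_, hF.isFracDeriv ha⟩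

lemma IsSchwartzLeft.fracDeriv_eq {F : ℝ → ℂ} (hF : IsSchwartzLeft 0 F) {a : ℝ} (ha : a ≤ 0) :
    fracDeriv F a = liouvilleExt fun n u => iteratedDerivWithin n F (Iic 0) (a - u) :=
  (hF.isFracDeriv_fracDeriv ha).unique (hF.isFracDeriv ha)

lemma IsSchwartzLeft.fracDeriv_nat {F : ℝ → ℂ} (hF : IsSchwartzLeft 0 F) {a : ℝ} (ha : a ≤ 0)
    (n : ℕ) : fracDeriv F a n = iteratedDerivWithin n F (Iic 0) a := by
  rw [hF.fracDeriv_eq ha, (hF.rapidTower ha).liouvilleExt_nat, sub_zero]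

/-! ### The meromorphic kernel `Γ(-s) ζ(-s) F^(s) x^s` -/

/-- The regular part is the difference quotient of `G = (s - w) Φ` at `w`, holomorphic across `w`;
the residue is `G w`. -/
lemma SimplePoleStrip.of_mul_eq {Φ G : ℂ → ℂ} {α β w : ℝ} (hα : α < w) (hβ : w < β)
    (hG : DifferentiableOn ℂ G {s | α < s.re ∧ s.re < β})
    (h : ∀ s : ℂ, α < s.re → s.re < β → s ≠ w → (s - w) * Φ s = G s)
    (hC : ∃ C : ℝ, ∀ s : ℂ, α < s.re → s.re < β → 1 ≤ |s.im| → ‖Φ s‖ ≤ C / s.im ^ 2) :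
    SimplePoleStrip Φ α β w (G w) := by
  refine ⟨⟨dslope G w, ?_, fun s h1 h2 h3 => ?_⟩, hC⟩
  · refine (Complex.differentiableOn_dslope ?_).mpr hG
    refine IsOpen.mem_nhds ?_ ⟨by simpa using hα, by simpa using hβ⟩
    exact (isOpen_lt continuous_const Complex.continuous_re).inter
      (isOpen_lt Complex.continuous_re continuous_const)
  · have hne := sub_ne_zero.mpr h3
    rw [dslope_of_ne _ h3, slope_def_field, ← h s h1 h2 h3]
    field_simp
    ring

/-- The integrand `Γ(-s) ζ(-s) E(s) x^s`, where `E` is the entire function attached to `g`. -/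
noncomputable def zetaKernel (g : ℕ → ℝ → ℂ) (x : ℝ) (s : ℂ) : ℂ :=
  Complex.Gamma (-s) * riemannZeta (-s) * liouvilleExt g s * (x : ℂ) ^ s

lemma Complex.differentiableAt_Gamma_of_pos_re {s : ℂ} (hs : 0 < s.re) :
    DifferentiableAt ℂ Complex.Gamma s :=
  Complex.differentiableAt_Gamma s fun m h => by
    have := congrArg Complex.re h
    simp at this
    linarith [(m.cast_nonneg : (0 : ℝ) ≤ m)]

lemma prod_range_cast_sub_self (k : ℕ) :
    ∏ j ∈ Finset.range k, (-(k : ℂ) + j) = (-1) ^ k * (k.factorial : ℂ) := by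
  rw [← Nat.descFactorial_self, Nat.descFactorial_eq_prod_range]
  push_cast
  rw [← Finset.card_range k, ← Finset.prod_const, Finset.card_range, ← Finset.prod_mul_distrib]
  refine Finset.prod_congr rfl fun j hj => ?_
  rw [Nat.cast_sub (Finset.mem_range.mp hj).le]
  ring

namespace RapidTower

variable {g : ℕ → ℝ → ℂ}

lemma exists_norm_zetaKernel_le (H : RapidTower g) {x : ℝ} (hx : 0 < x) (α β : ℝ) :
    ∃ C : ℝ, ∀ s : ℂ, α < s.re → s.re < β → 1 ≤ |s.im| →
      ‖zetaKernel g x s‖ ≤ C / s.im ^ 2 := by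
  obtain ⟨m, C₁, hC₁, h₁⟩ := exists_norm_riemannZeta_le_pow (-β)
  -- Order `m + 2` absorbs the growth `|Im s|^m` of `ζ` and leaves quadratic decay.
  obtain ⟨C₂, hC₂, h₂⟩ := H.exists_norm_Gamma_mul_liouvilleExt_le α β (m + 2)
  refine ⟨C₁ * C₂ * (x ^ α + x ^ β), fun s h1 h2 h3 => ?_⟩
  have b1 := h₁ (-s) (by rw [Complex.neg_re]; linarith) (by simpa using h3)
  rw [Complex.neg_im, abs_neg] at b1
  have b2 := h₂ s h1.le h2.le h3
  have b3 : ‖(x : ℂ) ^ s‖ ≤ x ^ α + x ^ β := by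
    rw [Complex.norm_cpow_eq_rpow_re_of_pos hx]
    have p1 : 0 ≤ x ^ α := by positivity
    have p2 : 0 ≤ x ^ β := by positivity
    rcases le_total x 1 with h | h
    · have := Real.rpow_le_rpow_of_exponent_ge hx h h1.le
      linarith
    · have := Real.rpow_le_rpow_of_exponent_le h h2.le
      linarith
  have hpos : 0 < |s.im| := by linarith
  have e : zetaKernel g x s =
      (Complex.Gamma (-s) * liouvilleExt g s) * riemannZeta (-s) * (x : ℂ) ^ s := by
    rw [zetaKernel]; ring
  rw [e, norm_mul, norm_mul, ← sq_abs s.im]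
  calc _ ≤ C₂ / |s.im| ^ (m + 2) * (C₁ * |s.im| ^ m) * (x ^ α + x ^ β) := by gcongr
    _ = _ := by
      rw [pow_add]
      field_simp

lemma differentiableAt_liouvilleExt_mul_cpow (H : RapidTower g) {x : ℝ} (hx : 0 < x) (s : ℂ) :
    DifferentiableAt ℂ (fun s => liouvilleExt g s * (x : ℂ) ^ s) s :=
  (H.differentiable_liouvilleExt s).mul
    (differentiableAt_id.const_cpow (Or.inl (by exact_mod_cast hx.ne')))

/-- Here `Γ(-s)` is holomorphic and the pole is that of `ζ(-s)`. The residue has a minus sign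
because `s + 1 = -(-s - 1)`. -/
lemma simplePoleStrip_neg_one (H : RapidTower g) {x : ℝ} (hx : 0 < x) :
    SimplePoleStrip (zetaKernel g x) (-2) 0 (-1) (-(liouvilleExt g (-1) / x)) := by
  have hG : DifferentiableOn ℂ (fun s => -(Complex.Gamma (-s) * riemannZeta₁ (-s) *
      (liouvilleExt g s * (x : ℂ) ^ s))) {s | -2 < s.re ∧ s.re < 0} := by
    intro s hs
    refine DifferentiableAt.differentiableWithinAt ?_
    have h1 : DifferentiableAt ℂ (fun s => Complex.Gamma (-s)) s :=
      (Complex.differentiableAt_Gamma_of_pos_re (s := -s) (by simpa using hs.2)).comp s (by fun_prop)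
    have h2 : DifferentiableAt ℂ (fun s => riemannZeta₁ (-s)) s :=
      (differentiable_riemannZeta₁ (-s)).comp s (by fun_prop)
    exact ((h1.mul h2).mul (H.differentiableAt_liouvilleExt_mul_cpow hx s)).neg
  have key := SimplePoleStrip.of_mul_eq (Φ := zetaKernel g x) (w := -1) (by norm_num)
    (by norm_num) hG (fun s h1 h2 h3 => ?_) (H.exists_norm_zetaKernel_le hx _ _)
  · convert key using 1
    simp [Complex.cpow_neg_one, div_eq_mul_inv]
  · have hs : -s ≠ 1 := fun h => h3 (by push_cast; linear_combination -h)
    have hs' : -s - 1 ≠ 0 := sub_ne_zero.mpr hs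
    simp only [zetaKernel]
    rw [riemannZeta_eq_inv_sub_mul hs]
    have : s - ((-1 : ℝ) : ℂ) = -(-s - 1) := by push_cast; ring
    rw [this]
    field_simp

/-- Here `ζ(-s)` is holomorphic. Writing `Γ(-s)` as `Γ(k + 1 - s)` over the product of the `j - s`
for `j ≤ k` isolates the vanishing factor `k - s`; the others give `(-1)^k k!` at `s = k`. -/
lemma simplePoleStrip_nat (H : RapidTower g) {x : ℝ} (hx : 0 < x) (k : ℕ) :
    SimplePoleStrip (zetaKernel g x) (k - 1) (k + 1) k
      (-((-1) ^ k / (k.factorial : ℂ) * riemannZeta (-(k : ℂ)) * (g k 0 * (x : ℂ) ^ k))) := by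
  have hprod : ∀ s : ℂ, (k : ℝ) - 1 < s.re → ∏ j ∈ Finset.range k, (-s + (j : ℂ)) ≠ 0 := by
    intro s hs
    refine Finset.prod_ne_zero_iff.mpr fun j hj h => ?_
    have hj' : (j : ℝ) + 1 ≤ k := by exact_mod_cast Finset.mem_range.mp hj
    have := congrArg Complex.re h
    simp at this
    linarith
  have hG : DifferentiableOn ℂ (fun s => -(Complex.Gamma (-s + (k + 1 : ℕ)) /
      (∏ j ∈ Finset.range k, (-s + (j : ℂ))) * riemannZeta (-s) *
      (liouvilleExt g s * (x : ℂ) ^ s))) {s | (k : ℝ) - 1 < s.re ∧ s.re < k + 1} := by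
    intro s hs
    refine DifferentiableAt.differentiableWithinAt ?_
    have h1 : DifferentiableAt ℂ (fun s => Complex.Gamma (-s + (k + 1 : ℕ))) s :=
      (Complex.differentiableAt_Gamma_of_pos_re (s := -s + (k + 1 : ℕ)) (by
        have := hs.2
        simp
        linarith)).comp s (by fun_prop)
    have h2 : DifferentiableAt ℂ (fun s => riemannZeta (-s)) s := by
      refine (differentiableAt_riemannZeta (s := -s) fun h => ?_).comp s (by fun_prop)
      have := congrArg Complex.re h
      simp at this
      linarith [hs.1, (k.cast_nonneg : (0 : ℝ) ≤ k)]
    have h3 : DifferentiableAt ℂ (fun s => ∏ j ∈ Finset.range k, (-s + (j : ℂ))) s := by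
      fun_prop
    exact (((h1.div h3 (hprod s hs.1)).mul h2).mul
      (H.differentiableAt_liouvilleExt_mul_cpow hx s)).neg
  have key := SimplePoleStrip.of_mul_eq (Φ := zetaKernel g x) (w := k) (by linarith)
    (by linarith) hG (fun s h1 h2 h3 => ?_) (H.exists_norm_zetaKernel_le hx _ _)
  · convert key using 1
    simp only [Complex.ofReal_natCast]
    rw [prod_range_cast_sub_self, H.liouvilleExt_nat, Complex.cpow_natCast]
    have : (-(k : ℂ) + (k + 1 : ℕ)) = 1 := by push_cast; ring
    rw [this, Complex.Gamma_one]
    rcases neg_one_pow_eq_or ℂ k with h | h <;> rw [h] <;> ring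
  · have h3' : -s + (k : ℂ) ≠ 0 := fun h => h3 (by
      simp only [Complex.ofReal_natCast]; linear_combination -h)
    have e := Complex.Gamma_add_nat_eq_prod (z := -s) (n := k + 1) (fun j hj => by
      rcases Nat.lt_succ_iff_lt_or_eq.mp hj with hj | rfl
      · exact Finset.prod_ne_zero_iff.mp (hprod s h1) j (Finset.mem_range.mpr hj)
      · exact h3')
    have hp := hprod s h1
    simp only [zetaKernel]
    rw [e, Finset.prod_range_succ]
    simp only [Complex.ofReal_natCast]
    field_simp
    ring

/-- The line `Re s = M - 1/2` separates the poles `M - 1` and `M`. Each induction step crosses one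
pole rightwards and so subtracts its residue, which is minus the summand. -/
lemma verticalIntegral_shift (H : RapidTower g) {x : ℝ} (hx : 0 < x) (M : ℕ) :
    verticalIntegral (-3 / 2) (zetaKernel g x) = liouvilleExt g (-1) / x
      + ∑ k ∈ Finset.range M,
          (-1) ^ k / (k.factorial : ℂ) * riemannZeta (-(k : ℂ)) * (g k 0 * (x : ℂ) ^ k)
      + verticalIntegral (M - 1 / 2) (zetaKernel g x) := by
  induction M with
  | zero =>
    have h := (H.simplePoleStrip_neg_one hx).verticalIntegral_sub (a := -3 / 2)
      (b := (0 : ℕ) - 1 / 2) (by norm_num) (by norm_num) (by norm_num) (by norm_num)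
    rw [Finset.sum_range_zero]
    linear_combination -h
  | succ M ih =>
    have h := (H.simplePoleStrip_nat hx M).verticalIntegral_sub (a := M - 1 / 2)
      (b := (M + 1 : ℕ) - 1 / 2) (by linarith) (by linarith) (by push_cast; linarith)
      (by push_cast; linarith)
    rw [ih, Finset.sum_range_succ]
    linear_combination -h

/-- The trivial zero `ζ(-2N) = 0` kills the residue at `2N`, hence the freedom of `c` in the whole
strip, `c = 2N` included. -/
lemma simplePoleStrip_two_mul (H : RapidTower g) {x : ℝ} (hx : 0 < x) {N : ℕ} (hN : 1 ≤ N) :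
    SimplePoleStrip (zetaKernel g x) (2 * N - 1) (2 * N + 1) (2 * N) 0 := by
  have h := H.simplePoleStrip_nat hx (2 * N)
  obtain ⟨n, rfl⟩ : ∃ n, N = n + 1 := ⟨N - 1, by omega⟩
  have hz : riemannZeta (-((2 * (n + 1) : ℕ) : ℂ)) = 0 := by
    rw [← riemannZeta_neg_two_mul_nat_add_one n]
    congr 1
    push_cast; ring
  rw [hz] at h
  simpa using h

lemma verticalIntegrable_neg (H : RapidTower g) {x : ℝ} (hx : 0 < x) :
    VerticalIntegrable (-3 / 2) (zetaKernel g x) :=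
  (H.simplePoleStrip_neg_one hx).verticalIntegrable (by norm_num) (by norm_num)
    (Or.inl (by norm_num))

lemma verticalIntegrable_pos (H : RapidTower g) {x : ℝ} (hx : 0 < x) {N : ℕ} (hN : 1 ≤ N) {c : ℝ}
    (hc : c ∈ Ioo (2 * (N : ℝ) - 1) (2 * (N : ℝ) + 1)) :
    VerticalIntegrable c (zetaKernel g x) :=
  (H.simplePoleStrip_two_mul hx hN).verticalIntegrable hc.1 hc.2 (Or.inr rfl)

lemma verticalIntegral_eq_residues_add (H : RapidTower g) {x : ℝ} (hx : 0 < x) {N : ℕ}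
    (hN : 1 ≤ N) {c : ℝ} (hc : c ∈ Ioo (2 * (N : ℝ) - 1) (2 * (N : ℝ) + 1)) :
    verticalIntegral (-3 / 2) (zetaKernel g x) = liouvilleExt g (-1) / x
      + ∑ k ∈ Finset.range (2 * N),
          (-1) ^ k / (k.factorial : ℂ) * riemannZeta (-(k : ℂ)) * (g k 0 * (x : ℂ) ^ k)
      + verticalIntegral c (zetaKernel g x) := by
  rw [H.verticalIntegral_shift hx (2 * N)]
  congr 1
  push_cast
  exact (H.simplePoleStrip_two_mul hx hN).verticalIntegral_eq (by linarith) (by linarith)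
    hc.1 hc.2

/-! ### Mellin inversion -/

lemma zetaKernel_neg (H : RapidTower g) (x : ℝ) {z : ℂ} (hz : 0 < z.re) :
    zetaKernel g x (-z) = mellin (g 0) z * riemannZeta z * (x : ℂ) ^ (-z) := by
  have hG := Complex.Gamma_ne_zero_of_re_pos hz
  rw [zetaKernel, H.liouvilleExt_eq (n := 0) (by simpa using hz)]
  simp only [neg_neg, Nat.cast_zero, zero_sub]
  field_simp

lemma continuous_mellin_line (H : RapidTower g) (n : ℕ) {σ : ℝ} (hσ : 0 < σ) :
    Continuous fun y : ℝ => mellin (g n) (σ + y * Complex.I) := by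
  refine continuous_iff_continuousAt.mpr fun y => ?_
  have h := (H.differentiableAt_mellin n (s := σ + y * Complex.I) (by simpa using hσ)).continuousAt
  exact ContinuousAt.comp (f := fun y : ℝ => (σ : ℂ) + y * Complex.I) h (by fun_prop)

lemma integrable_mellin_line (H : RapidTower g) {σ : ℝ} (hσ : 0 < σ) :
    Integrable fun y : ℝ => mellin (g 0) (σ + y * Complex.I) := by
  obtain ⟨C, -, hC⟩ := H.exists_norm_Gamma_mul_liouvilleExt_le (-σ) (-σ) 2
  refine integrable_of_continuous_of_sq_decay (C := C) (H.continuous_mellin_line 0 hσ) fun y hy => ?_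
  have hre : (-((σ : ℂ) + y * Complex.I)).re = -σ := by simp
  have him : (-((σ : ℂ) + y * Complex.I)).im = -y := by simp
  have h := hC (-(σ + y * Complex.I)) hre.ge hre.le (by rwa [him, abs_neg])
  rw [him, abs_neg, sq_abs, neg_neg, H.liouvilleExt_eq (n := 0) (by rw [hre]; simpa using hσ)] at h
  have hG := Complex.Gamma_ne_zero_of_re_pos (s := σ + y * Complex.I) (by simpa using hσ)
  simpa [mul_div_cancel₀ _ hG] using h

/-- Mellin inversion at each point `(n + 1) x`, with the sum and integral exchanged thanks to the
convergence of the series of `(n + 1)^(-3/2)`. Absolute convergence of the series is part of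
`HasSum` in `ℂ`. -/
lemma hasSum_verticalIntegral (H : RapidTower g) {x : ℝ} (hx : 0 < x) :
    HasSum (fun n : ℕ => g 0 (((n : ℝ) + 1) * x)) (verticalIntegral (-3 / 2) (zetaKernel g x)) := by
  set z : ℝ → ℂ := fun y => ((3 / 2 : ℝ) : ℂ) + y * Complex.I with hz
  have hzre : ∀ y, (z y).re = 3 / 2 := fun y => by simp [hz]
  have hM := H.integrable_mellin_line (σ := 3 / 2) (by norm_num)
  have hxn : ∀ n : ℕ, 0 < ((n : ℝ) + 1) * x := fun n => by positivity
  set f : ℕ → ℝ → ℂ := fun n y =>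
    (((((n : ℝ) + 1) * x : ℝ)) : ℂ) ^ (-z y) • mellin (g 0) (z y) with hf
  have hnorm : ∀ n y, ‖f n y‖ = (((n : ℝ) + 1) * x) ^ (-(3 / 2) : ℝ) * ‖mellin (g 0) (z y)‖ :=
    fun n y => by
      rw [hf, norm_smul, Complex.norm_cpow_eq_rpow_re_of_pos (hxn n), Complex.neg_re, hzre]
  have hint : ∀ n, Integrable (f n) := fun n => by
    refine (hM.norm.const_mul ((((n : ℝ) + 1) * x) ^ (-(3 / 2) : ℝ))).mono' ?_
      (ae_of_all _ fun y => (hnorm n y).le)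
    refine Continuous.aestronglyMeasurable ?_
    refine Continuous.mul ?_ (H.continuous_mellin_line 0 (σ := 3 / 2) (by norm_num))
    exact Continuous.const_cpow (by fun_prop) (Or.inl (by exact_mod_cast (hxn n).ne'))
  have hsum : Summable fun n => ∫ y, ‖f n y‖ := by
    simp_rw [hnorm, integral_const_mul]
    refine Summable.mul_right _ ?_
    have h1 : Summable fun n : ℕ => ((n : ℝ) + 1) ^ (-(3 / 2) : ℝ) := by
      have := (summable_nat_add_iff 1).mpr
        (Real.summable_nat_rpow (p := -(3 / 2)).mpr (by norm_num))
      simpa using this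
    refine (h1.mul_right (x ^ (-(3 / 2) : ℝ))).congr fun n => ?_
    rw [Real.mul_rpow (by positivity) hx.le]
  have key := (hasSum_integral_of_summable_integral_norm hint hsum).const_smul
    ((1 / (2 * Real.pi) : ℝ))
  have hg : ∀ n : ℕ, (1 / (2 * Real.pi) : ℝ) • ∫ y, f n y = g 0 (((n : ℝ) + 1) * x) := fun n => by
    refine mellinInv_mellin_eq (3 / 2) (g 0) (hxn n)
      (H.mellinConvergent 0 (by rw [Complex.ofReal_re]; norm_num)) hM ?_
    exact (H.hasDerivAt 0 _ (hxn n)).continuousAt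
  simp_rw [hg] at key
  suffices hv : verticalIntegral (-3 / 2) (zetaKernel g x) =
      (1 / (2 * Real.pi) : ℝ) • ∫ y, ∑' n, f n y by
    rw [hv]
    exact key
  have hts : ∀ y, ∑' n, f n y = zetaKernel g x (-z y) := fun y => by
    rw [H.zetaKernel_neg x (by rw [hzre]; norm_num),
      zeta_eq_tsum_one_div_nat_add_one_cpow (by rw [hzre]; norm_num), ← tsum_mul_left,
      ← tsum_mul_right]
    refine tsum_congr fun n => ?_
    simp only [hf, smul_eq_mul]
    have hn : (0 : ℝ) ≤ (n : ℝ) + 1 := by positivity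
    rw [Complex.ofReal_mul, Complex.mul_cpow_ofReal_nonneg hn hx.le, Complex.cpow_neg _ (z y)]
    push_cast
    ring
  simp_rw [hts]
  -- Since `s = -z`, the upward line in `z` becomes a downward one in `s`; `y ↦ -y` restores the
  -- orientation.
  rw [← integral_neg_eq_self, verticalIntegral, integral_mul_const]
  have e : ∀ y : ℝ, -z (-y) = ((-3 / 2 : ℝ) : ℂ) + y * Complex.I := fun y => by
    simp only [hz]; push_cast; ring
  simp_rw [e]
  have hpi : (Real.pi : ℂ) ≠ 0 := by exact_mod_cast Real.pi_ne_zero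
  rw [Complex.real_smul]
  push_cast
  field_simp

end RapidTower

/-! ### Special values and finite sums -/

/-- Functional equation at `2(j + 1)`: the Gamma factor equals `(2j + 1)!` and the cosine is `cos((j
+ 1)π)`. -/
lemma riemannZeta_neg_odd_div_factorial (j : ℕ) :
    riemannZeta (-((2 * j + 1 : ℕ) : ℂ)) / ((2 * j + 1).factorial : ℂ) =
      (-1) ^ (j + 1) * (2 * riemannZeta (2 * ((j + 1 : ℕ) : ℂ)) /
        (2 * (Real.pi : ℂ)) ^ (2 * (j + 1))) := by
  have h := riemannZeta_one_sub (s := ((2 * (j + 1) : ℕ) : ℂ)) (fun n h => by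
      have := congrArg Complex.re h
      simp at this
      linarith [(n.cast_nonneg : (0 : ℝ) ≤ n), (j.cast_nonneg : (0 : ℝ) ≤ j)]) (fun h => by
      have : 2 * (j + 1) = 1 := by exact_mod_cast h
      omega)
  have e1 : (1 : ℂ) - ((2 * (j + 1) : ℕ) : ℂ) = -((2 * j + 1 : ℕ) : ℂ) := by push_cast; ring
  have e2 : Complex.Gamma ((2 * (j + 1) : ℕ) : ℂ) = ((2 * j + 1).factorial : ℂ) := by
    rw [← Complex.Gamma_nat_eq_factorial]
    congr 1
    push_cast; ring
  have e3 : Complex.cos (Real.pi * ((2 * (j + 1) : ℕ) : ℂ) / 2) = (-1) ^ (j + 1) := by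
    rw [show (Real.pi : ℂ) * ((2 * (j + 1) : ℕ) : ℂ) / 2 = ((j + 1 : ℕ) : ℂ) * Real.pi by
      push_cast; ring]
    exact_mod_cast congrArg Complex.ofReal (Real.cos_nat_mul_pi (j + 1))
  have hf : ((2 * j + 1).factorial : ℂ) ≠ 0 := by exact_mod_cast (Nat.factorial_pos _).ne'
  have hpi : (2 * (Real.pi : ℂ)) ≠ 0 := by simp [Real.pi_ne_zero]
  rw [e1, e2, e3, Complex.cpow_neg, Complex.cpow_natCast] at h
  rw [h, show ((2 * (j + 1) : ℕ) : ℂ) = 2 * ((j + 1 : ℕ) : ℂ) by push_cast; ring]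
  field_simp

/-- The term `k = 0` is `ζ(0) = -1/2`, the even terms with `k ≥ 2` are trivial zeros, and the odd
terms are rewritten by the functional equation. -/
lemma sum_range_two_mul_riemannZeta (d : ℕ → ℂ) (N : ℕ) :
    ∑ k ∈ Finset.range (2 * (N + 1)), riemannZeta (-(k : ℂ)) * d k / (k.factorial : ℂ) =
      -(d 0) / 2 + ∑ k ∈ Finset.Icc 1 (N + 1),
        (-1 : ℂ) ^ k * (2 * riemannZeta (2 * (k : ℂ)) / (2 * (Real.pi : ℂ)) ^ (2 * k)) *
          d (2 * k - 1) := by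
  have hodd : ∀ j : ℕ, riemannZeta (-((2 * j + 1 : ℕ) : ℂ)) * d (2 * j + 1) /
      ((2 * j + 1).factorial : ℂ) = (-1) ^ (j + 1) * (2 * riemannZeta (2 * ((j + 1 : ℕ) : ℂ)) /
        (2 * (Real.pi : ℂ)) ^ (2 * (j + 1))) * d (2 * (j + 1) - 1) := fun j => by
    rw [← riemannZeta_neg_odd_div_factorial, show 2 * (j + 1) - 1 = 2 * j + 1 by omega]
    ring
  induction N with
  | zero =>
    have h := hodd 0
    rw [show 2 * (0 + 1) = 1 + 1 from rfl, Finset.sum_range_succ, Finset.sum_range_one]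
    simp only [mul_zero, zero_add] at h
    rw [h]
    simp [riemannZeta_zero]
    ring
  | succ N ih =>
    have hz : riemannZeta (-((2 * (N + 1) : ℕ) : ℂ)) = 0 := by
      rw [← riemannZeta_neg_two_mul_nat_add_one N]
      congr 1
      push_cast; ring
    rw [show 2 * (N + 1 + 1) = 2 * (N + 1) + 1 + 1 by ring, Finset.sum_range_succ,
      Finset.sum_range_succ, ih, hz, hodd (N + 1), Finset.sum_Icc_succ_top (show 1 ≤ N + 1 + 1 by omega)]
    ring

/-- This change of endpoints turns the coefficient `-1/2` coming from `ζ(0)` into the `+1/2` of the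
final formula. -/
lemma sum_Ico_eq_sum_Ioc_add {M : Type*} [AddCommGroup M] (f : ℕ → M) {p q : ℕ} (h : p ≤ q) :
    ∑ n ∈ Finset.Ico p q, f n = ∑ n ∈ Finset.Ioc p q, f n + (f p - f q) := by
  induction q, h using Nat.le_induction with
  | base => simp
  | succ q hq ih =>
    rw [Finset.sum_Ico_succ_top hq, Finset.sum_Ioc_succ_top hq, ih]
    abel

lemma sum_Ioc_eq_sub_of_hasSum {f : ℕ → ℂ} {p q : ℕ} (hpq : p ≤ q) {A B : ℂ}
    (hA : HasSum (fun n => f (p + (n + 1))) A) (hB : HasSum (fun n => f (q + (n + 1))) B) :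
    ∑ n ∈ Finset.Ioc p q, f n = A - B := by
  induction q, hpq using Nat.le_induction generalizing B with
  | base => rw [hA.unique hB]; simp
  | succ q hq ih =>
    have h : HasSum (fun n => f (q + (n + 1))) (f (q + 1) + B) := by
      refine (hasSum_nat_add_iff' 1).mp ?_
      simpa [add_assoc, add_comm, add_left_comm] using hB
    rw [Finset.sum_Ioc_succ_top hq, ih h]
    ring

lemma verticalIntegral_sub {c : ℝ} {f g : ℂ → ℂ} (hf : VerticalIntegrable c f)
    (hg : VerticalIntegrable c g) :
    verticalIntegral c (fun s => f s - g s) = verticalIntegral c f - verticalIntegral c g := by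
  unfold verticalIntegral
  unfold VerticalIntegrable at hf hg
  simp_rw [integral_mul_const]
  rw [integral_sub hf hg]
  ring

/-! ### Summation formulas for rapidly decreasing functions on a half-line -/

namespace IsSchwartzLeft

variable {F : ℝ → ℂ}

lemma zetaKernel_eq (hF : IsSchwartzLeft 0 F) {a : ℝ} (ha : a ≤ 0) (t : ℝ) :
    (fun s => Complex.Gamma (-s) * riemannZeta (-s) * fracDeriv F a s * ((-t : ℝ) : ℂ) ^ s) =
      zetaKernel (fun n u => iteratedDerivWithin n F (Iic 0) (a - u)) (-t) := by
  rw [hF.fracDeriv_eq ha]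
  rfl

lemma verticalIntegrable_neg (hF : IsSchwartzLeft 0 F) {a t : ℝ} (ha : a ≤ 0) (ht : t < 0) :
    VerticalIntegrable (-3 / 2) (fun s =>
      Complex.Gamma (-s) * riemannZeta (-s) * fracDeriv F a s * ((-t : ℝ) : ℂ) ^ s) := by
  rw [hF.zetaKernel_eq ha]
  exact (hF.rapidTower ha).verticalIntegrable_neg (neg_pos.mpr ht)

lemma verticalIntegrable_pos (hF : IsSchwartzLeft 0 F) {a t : ℝ} (ha : a ≤ 0) (ht : t < 0)
    {N : ℕ} (hN : 1 ≤ N) {c : ℝ} (hc : c ∈ Ioo (2 * (N : ℝ) - 1) (2 * (N : ℝ) + 1)) :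
    VerticalIntegrable c (fun s =>
      Complex.Gamma (-s) * riemannZeta (-s) * fracDeriv F a s * ((-t : ℝ) : ℂ) ^ s) := by
  rw [hF.zetaKernel_eq ha]
  exact (hF.rapidTower ha).verticalIntegrable_pos (neg_pos.mpr ht) hN hc

lemma hasSum_verticalIntegral (hF : IsSchwartzLeft 0 F) {a t : ℝ} (ha : a ≤ 0) (ht : t < 0) :
    HasSum (fun n : ℕ => F (a + ((n : ℝ) + 1) * t)) (verticalIntegral (-3 / 2) (fun s =>
      Complex.Gamma (-s) * riemannZeta (-s) * fracDeriv F a s * ((-t : ℝ) : ℂ) ^ s)) := by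
  rw [hF.zetaKernel_eq ha]
  convert (hF.rapidTower ha).hasSum_verticalIntegral (neg_pos.mpr ht) using 2 with n
  rw [iteratedDerivWithin_zero]
  congr 1
  ring

lemma verticalIntegral_eq_residues_add (hF : IsSchwartzLeft 0 F) {a t : ℝ} (ha : a ≤ 0)
    (ht : t < 0) {N : ℕ} (hN : 1 ≤ N) {c : ℝ}
    (hc : c ∈ Ioo (2 * (N : ℝ) - 1) (2 * (N : ℝ) + 1)) :
    verticalIntegral (-3 / 2) (fun s =>
        Complex.Gamma (-s) * riemannZeta (-s) * fracDeriv F a s * ((-t : ℝ) : ℂ) ^ s) =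
      -(fracDeriv F a (-1) / (t : ℂ))
        + ∑ k ∈ Finset.range (2 * N),
            riemannZeta (-(k : ℂ)) * (iteratedDerivWithin k F (Iic 0) a * (t : ℂ) ^ k)
              / (k.factorial : ℂ)
        + verticalIntegral c (fun s =>
            Complex.Gamma (-s) * riemannZeta (-s) * fracDeriv F a s * ((-t : ℝ) : ℂ) ^ s) := by
  rw [hF.zetaKernel_eq ha,
    (hF.rapidTower ha).verticalIntegral_eq_residues_add (neg_pos.mpr ht) hN hc, hF.fracDeriv_eq ha]
  congr 2
  · push_cast
    rw [div_neg]
  · refine Finset.sum_congr rfl fun k _ => ?_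
    rw [sub_zero]
    push_cast
    rw [neg_pow (t : ℂ) k]
    -- The sign in the residue of `Γ(-s)` cancels the sign in `(-t)^k`.
    have h : ((-1 : ℂ) ^ k) * (-1) ^ k = 1 := by rw [← mul_pow]; simp
    linear_combination (riemannZeta (-(k : ℂ)) * iteratedDerivWithin k F (Iic 0) a * (t : ℂ) ^ k
      / (k.factorial : ℂ)) * h

lemma kernel_sub (p q : ℂ → ℂ) (t : ℝ) :
    (fun s => Complex.Gamma (-s) * riemannZeta (-s) * (p s - q s) * ((-t : ℝ) : ℂ) ^ s) =
      fun s => Complex.Gamma (-s) * riemannZeta (-s) * p s * ((-t : ℝ) : ℂ) ^ s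
        - Complex.Gamma (-s) * riemannZeta (-s) * q s * ((-t : ℝ) : ℂ) ^ s := by
  funext s
  ring

lemma sum_Ioc_eq (hF : IsSchwartzLeft 0 F) {t : ℝ} (ht : t < 0) {p q : ℕ} (hpq : p ≤ q) :
    ∑ n ∈ Finset.Ioc p q, F ((n : ℝ) * t) =
      verticalIntegral (-3 / 2) (fun s => Complex.Gamma (-s) * riemannZeta (-s)
        * (fracDeriv F ((p : ℝ) * t) s - fracDeriv F ((q : ℝ) * t) s)
        * ((-t : ℝ) : ℂ) ^ s) := by
  have hn : ∀ n : ℕ, (n : ℝ) * t ≤ 0 := fun n => mul_nonpos_of_nonneg_of_nonpos n.cast_nonneg ht.le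
  rw [kernel_sub, verticalIntegral_sub (hF.verticalIntegrable_neg (hn p) ht)
    (hF.verticalIntegrable_neg (hn q) ht)]
  refine sum_Ioc_eq_sub_of_hasSum (f := fun n : ℕ => F ((n : ℝ) * t)) hpq ?_ ?_
  · convert hF.hasSum_verticalIntegral (hn p) ht using 3 with n
    push_cast; ring
  · convert hF.hasSum_verticalIntegral (hn q) ht using 3 with n
    push_cast; ring

lemma sum_Ico_eq (hF : IsSchwartzLeft 0 F) {t : ℝ} (ht : t < 0) {p q : ℕ} (hpq : p ≤ q)
    {N : ℕ} (hN : 1 ≤ N) {c : ℝ} (hc : c ∈ Ioo (2 * (N : ℝ) - 1) (2 * (N : ℝ) + 1)) :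
    ∑ n ∈ Finset.Ico p q, F ((n : ℝ) * t) =
      -((fracDeriv F ((p : ℝ) * t) (-1) - fracDeriv F ((q : ℝ) * t) (-1)) / (t : ℂ))
        + ∑ k ∈ Finset.Icc 1 N,
            (-1 : ℂ) ^ k * (2 * riemannZeta (2 * (k : ℂ)) / (2 * (Real.pi : ℂ)) ^ (2 * k))
              * (iteratedDerivWithin (2 * k - 1) F (Iic 0) ((p : ℝ) * t)
                - iteratedDerivWithin (2 * k - 1) F (Iic 0) ((q : ℝ) * t))
              * (t : ℂ) ^ (2 * k - 1)
        + (F ((p : ℝ) * t) - F ((q : ℝ) * t)) / 2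
        + verticalIntegral c (fun s =>
            Complex.Gamma (-s) * riemannZeta (-s)
              * (fracDeriv F ((p : ℝ) * t) s - fracDeriv F ((q : ℝ) * t) s)
              * ((-t : ℝ) : ℂ) ^ s) := by
  have hn : ∀ n : ℕ, (n : ℝ) * t ≤ 0 := fun n => mul_nonpos_of_nonneg_of_nonpos n.cast_nonneg ht.le
  rw [sum_Ico_eq_sum_Ioc_add (fun n : ℕ => F ((n : ℝ) * t)) hpq, hF.sum_Ioc_eq ht hpq, kernel_sub,
    verticalIntegral_sub (hF.verticalIntegrable_neg (hn p) ht)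
      (hF.verticalIntegrable_neg (hn q) ht),
    verticalIntegral_sub (hF.verticalIntegrable_pos (hn p) ht hN hc)
      (hF.verticalIntegrable_pos (hn q) ht hN hc),
    hF.verticalIntegral_eq_residues_add (hn p) ht hN hc,
    hF.verticalIntegral_eq_residues_add (hn q) ht hN hc]
  obtain ⟨N, rfl⟩ : ∃ n, N = n + 1 := ⟨N - 1, by omega⟩
  rw [sum_range_two_mul_riemannZeta (fun k => iteratedDerivWithin k F (Iic 0) ((p : ℝ) * t) * t ^ k),
    sum_range_two_mul_riemannZeta (fun k => iteratedDerivWithin k F (Iic 0) ((q : ℝ) * t) * t ^ k)]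
  simp only [iteratedDerivWithin_zero, pow_zero, mul_one, mul_sub, sub_mul, Finset.sum_sub_distrib,
    sub_div, ← mul_assoc]
  ring

/-- At `s = -1` both `Γ(-s)` and the power of `u` equal `1`, leaving a translated integral.
Integrability is recorded so that two such half-line integrals can be subtracted. -/
lemma fracDeriv_neg_one (hF : IsSchwartzLeft 0 F) {a : ℝ} (ha : 0 ≤ a) :
    IntegrableOn (fun u => F (-u)) (Ioi a) ∧
      fracDeriv F (-a) (-1) = ∫ u in Ioi a, F (-u) := by
  have ha' : -a ≤ 0 := neg_nonpos.mpr ha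
  have hi := (hF.rapidTower ha').mellinConvergent 0 (s := 1) (by simp)
  have hmp : MeasurePreserving (fun u : ℝ => a + u) volume volume :=
    measurePreserving_add_left volume a
  have hemb : MeasurableEmbedding (fun u : ℝ => a + u) := measurableEmbedding_addLeft a
  have hpre : (fun u : ℝ => a + u) ⁻¹' Ioi a = Ioi 0 := by ext u; simp
  have hfun : ∀ u : ℝ, F (-a - u) = F (-(a + u)) := fun u => by rw [neg_add']
  simp only [MellinConvergent, sub_self, Complex.cpow_zero, one_smul, iteratedDerivWithin_zero,
    hfun] at hi
  constructor
  · rw [← hmp.integrableOn_comp_preimage hemb, hpre]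
    exact hi
  · rw [(hF.isFracDeriv_fracDeriv ha').2 (-1) (by simp), ← hmp.setIntegral_preimage_emb hemb _ (Ioi a),
      hpre]
    simp [hfun]

end IsSchwartzLeft

lemma iteratedDerivWithin_Ici_eq {F G : ℝ → ℂ} (hG : ∀ u : ℝ, 0 ≤ u → G u = F (-u)) (n : ℕ)
    {a : ℝ} (ha : 0 ≤ a) : iteratedDerivWithin n G (Ici 0) a =
      (-1) ^ n * iteratedDerivWithin n F (Iic 0) (-a) := by
  rw [iteratedDerivWithin_congr (s := Ici (0 : ℝ)) (g := fun u => F (-u)) (fun u hu => hG u hu) ha,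
    iteratedDerivWithin_comp_neg]
  simp

theorem mainTheorem8 (F : ℝ → ℂ) (hF : IsSchwartzLeft 0 F) :
    -- the complex-order derivatives `F^(s)(a)` are well defined and extend the usual ones
    (∀ a : ℝ, a ≤ 0 →
      (∃! D : ℂ → ℂ, IsFracDeriv F a D) ∧
      ∀ n : ℕ, fracDeriv F a (n : ℂ) = iteratedDerivWithin n F (Iic 0) a) ∧
    -- all the integrals over vertical lines below converge absolutely
    (∀ a t : ℝ, a ≤ 0 → t < 0 →
      VerticalIntegrable (-3 / 2) (fun s =>
        Complex.Gamma (-s) * riemannZeta (-s) * fracDeriv F a s * ((-t : ℝ) : ℂ) ^ s) ∧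
      ∀ N : ℕ, 1 ≤ N → ∀ c ∈ Ioo (2 * (N : ℝ) - 1) (2 * (N : ℝ) + 1),
        VerticalIntegrable c (fun s =>
          Complex.Gamma (-s) * riemannZeta (-s) * fracDeriv F a s * ((-t : ℝ) : ℂ) ^ s)) ∧
    -- the infinite sum
    (∀ t : ℝ, t < 0 →
      HasSum (fun n : ℕ => F (((n : ℝ) + 1) * t))
        (verticalIntegral (-3 / 2) (fun s =>
          Complex.Gamma (-s) * riemannZeta (-s) * fracDeriv F 0 s * ((-t : ℝ) : ℂ) ^ s)) ∧
      ∀ N : ℕ, 1 ≤ N → ∀ c ∈ Ioo (2 * (N : ℝ) - 1) (2 * (N : ℝ) + 1),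
        HasSum (fun n : ℕ => F (((n : ℝ) + 1) * t))
          (-(fracDeriv F 0 (-1) / (t : ℂ))
            + ∑ k ∈ Finset.range (2 * N),
                riemannZeta (-(k : ℂ)) * iteratedDerivWithin k F (Iic 0) 0 * (t : ℂ) ^ k
                  / (k.factorial : ℂ)
            + verticalIntegral c (fun s =>
                Complex.Gamma (-s) * riemannZeta (-s) * fracDeriv F 0 s
                  * ((-t : ℝ) : ℂ) ^ s))) ∧
    -- finite sums of values `F(nt)`
    (∀ t : ℝ, t < 0 → ∀ p q : ℕ, p < q →
      ∑ n ∈ Finset.Ioc p q, F ((n : ℝ) * t) =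
        verticalIntegral (-3 / 2) (fun s =>
          Complex.Gamma (-s) * riemannZeta (-s)
            * (fracDeriv F ((p : ℝ) * t) s - fracDeriv F ((q : ℝ) * t) s)
            * ((-t : ℝ) : ℂ) ^ s) ∧
      ∀ N : ℕ, 1 ≤ N → ∀ c ∈ Ioo (2 * (N : ℝ) - 1) (2 * (N : ℝ) + 1),
        ∑ n ∈ Finset.Ico p q, F ((n : ℝ) * t) =
          -((fracDeriv F ((p : ℝ) * t) (-1) - fracDeriv F ((q : ℝ) * t) (-1)) / (t : ℂ))
            + ∑ k ∈ Finset.Icc 1 N,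
                (-1 : ℂ) ^ k * (2 * riemannZeta (2 * (k : ℂ)) / (2 * (Real.pi : ℂ)) ^ (2 * k))
                  * (iteratedDerivWithin (2 * k - 1) F (Iic 0) ((p : ℝ) * t)
                    - iteratedDerivWithin (2 * k - 1) F (Iic 0) ((q : ℝ) * t))
                  * (t : ℂ) ^ (2 * k - 1)
            + (F ((p : ℝ) * t) - F ((q : ℝ) * t)) / 2
            + verticalIntegral c (fun s =>
                Complex.Gamma (-s) * riemannZeta (-s)
                  * (fracDeriv F ((p : ℝ) * t) s - fracDeriv F ((q : ℝ) * t) s)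
                  * ((-t : ℝ) : ℂ) ^ s)) ∧
    -- finite sums of values `G(n)`, where `G(u) = F(-u)` on `[0, +∞[`
    (∀ G : ℝ → ℂ, (∀ u : ℝ, 0 ≤ u → G u = F (-u)) →
      ∀ p q : ℕ, p < q → ∀ N : ℕ, 1 ≤ N →
      ∀ c ∈ Ioo (2 * (N : ℝ) - 1) (2 * (N : ℝ) + 1),
        (G p + G q) / 2 + ∑ n ∈ Finset.Ioo p q, G n =
          (∫ u in (p : ℝ)..(q : ℝ), G u)
            + ∑ k ∈ Finset.Icc 1 N,
                (-1 : ℂ) ^ k * (2 * riemannZeta (2 * (k : ℂ)) / (2 * (Real.pi : ℂ)) ^ (2 * k))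
                  * (iteratedDerivWithin (2 * k - 1) G (Ici 0) (p : ℝ)
                    - iteratedDerivWithin (2 * k - 1) G (Ici 0) (q : ℝ))
            + verticalIntegral c (fun s =>
                Complex.Gamma (-s) * riemannZeta (-s)
                  * (fracDeriv F (-(p : ℝ)) s - fracDeriv F (-(q : ℝ)) s))) := by
  refine ⟨fun a ha => ⟨⟨fracDeriv F a, hF.isFracDeriv_fracDeriv ha,
      fun D hD => hD.unique (hF.isFracDeriv_fracDeriv ha)⟩, hF.fracDeriv_nat ha⟩,
    fun a t ha ht => ⟨hF.verticalIntegrable_neg ha ht,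
      fun N hN c hc => hF.verticalIntegrable_pos ha ht hN hc⟩,
    fun t ht => ?_,
    fun t ht p q hpq => ⟨hF.sum_Ioc_eq ht hpq.le, fun N hN c hc => hF.sum_Ico_eq ht hpq.le hN hc⟩,
    fun G hG p q hpq N hN c hc => ?_⟩
  · have h := hF.hasSum_verticalIntegral le_rfl ht
    simp only [zero_add] at h
    refine ⟨h, fun N hN c hc => ?_⟩
    rw [hF.verticalIntegral_eq_residues_add le_rfl ht hN hc] at h
    simpa only [← mul_assoc] using h
  -- With `t = -1` the factor `(-t)^s` is `1`.
  · have h := hF.sum_Ico_eq (t := -1) (by norm_num) hpq.le hN hc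
    have hp : (0 : ℝ) ≤ p := p.cast_nonneg
    have hq : (0 : ℝ) ≤ q := q.cast_nonneg
    have hpq' : (p : ℝ) ≤ q := by exact_mod_cast hpq.le
    have hint : ∫ u in (p : ℝ)..(q : ℝ), G u =
        fracDeriv F (-(p : ℝ)) (-1) - fracDeriv F (-(q : ℝ)) (-1) := by
      rw [(hF.fracDeriv_neg_one hp).2, (hF.fracDeriv_neg_one hq).2,
        intervalIntegral.integral_Ioi_sub_Ioi (hF.fracDeriv_neg_one hp).1 hpq']
      refine intervalIntegral.integral_congr fun u hu => hG u ?_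
      rw [uIcc_of_le hpq'] at hu
      exact hp.trans hu.1
    -- Reflection changes the sign of odd derivatives; this is compensated by `t^(2k-1) = -1` at `t
    -- = -1`.
    have hder : ∀ k ∈ Finset.Icc 1 N, ∀ n : ℕ,
        iteratedDerivWithin (2 * k - 1) G (Ici 0) (n : ℝ) =
          -iteratedDerivWithin (2 * k - 1) F (Iic 0) (-(n : ℝ)) := fun k hk n => by
      have hodd : Odd (2 * k - 1) := ⟨k - 1, by have := (Finset.mem_Icc.mp hk).1; omega⟩
      rw [iteratedDerivWithin_Ici_eq hG _ n.cast_nonneg, hodd.neg_one_pow, neg_one_mul]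
    have hpow : ∀ k ∈ Finset.Icc 1 N, (-1 : ℂ) ^ (2 * k - 1) = -1 := fun k hk => by
      have hodd : Odd (2 * k - 1) := ⟨k - 1, by have := (Finset.mem_Icc.mp hk).1; omega⟩
      exact hodd.neg_one_pow
    -- Taking out the term `n = p` and moving `(G p - G q) / 2` across leaves the trapezoidal term
    -- `(G p + G q) / 2`.
    have hsum : ∑ n ∈ Finset.Ico p q, F ((n : ℝ) * (-1)) = G p + ∑ n ∈ Finset.Ioo p q, G n := by
      rw [← Finset.Ioo_insert_left hpq, Finset.sum_insert (by simp), mul_neg_one, hG p hp]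
      congr 1
      refine Finset.sum_congr rfl fun n _ => ?_
      rw [mul_neg_one, hG n n.cast_nonneg]
    rw [hsum] at h
    simp only [mul_neg_one, neg_neg, Complex.ofReal_one, Complex.one_cpow, mul_one,
      Complex.ofReal_neg, div_neg, div_one] at h
    rw [← hint, ← hG p hp, ← hG q hq] at h
    have hs : ∑ k ∈ Finset.Icc 1 N,
          (-1 : ℂ) ^ k * (2 * riemannZeta (2 * (k : ℂ)) / (2 * (Real.pi : ℂ)) ^ (2 * k))
            * (iteratedDerivWithin (2 * k - 1) F (Iic 0) (-(p : ℝ))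
              - iteratedDerivWithin (2 * k - 1) F (Iic 0) (-(q : ℝ)))
            * (-1 : ℂ) ^ (2 * k - 1) =
        ∑ k ∈ Finset.Icc 1 N,
          (-1 : ℂ) ^ k * (2 * riemannZeta (2 * (k : ℂ)) / (2 * (Real.pi : ℂ)) ^ (2 * k))
            * (iteratedDerivWithin (2 * k - 1) G (Ici 0) (p : ℝ)
              - iteratedDerivWithin (2 * k - 1) G (Ici 0) (q : ℝ)) :=
      Finset.sum_congr rfl fun k hk => by
        rw [hder k hk, hder k hk, hpow k hk]
        ring
    rw [hs] at h
    linear_combination h
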